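/- Let $(x_n)_{n\ge 1}$ be a sequence of positive real numbers for which there exist $c>0$ and $\eta\in(2/3,1]$ such that $$x_{n+1}-x_n\ \ge\ \frac{c}{n^{1-\eta}}\qquad\text{for all } n\ge 1.$$ For $N\ge 1$ and $0<\gamma\le 1$ let $E^*_{N,\gamma}$ be the number of quadruples of integers $1\le n_1,n_2,n_3,n_4\le N$ with $|x_{n_1}-x_{n_2}+x_{n_3}-x_{n_4}|<\gamma$. Assume that there exist $\delta>0$ and $\kappa\in[0,1)$ such that, as $N\to\infty$, $$E^*_{N,1/N}\ll N^{3-\kappa-\delta}\qquad\text{and}\qquad \sum_{\substack{1\le n_1<n_2\le N\\ x_{n_2}-x_{n_1}\ge 1}}\frac{1}{\sqrt{x_{n_2}-x_{n_1}}}\ll N^{1+\kappa/2},$$ where the implied constants do not depend on $N$. Then $(x_n)_{n\ge1}$ is metric Poissonian; that is, for Lebesgue-almost every $\alpha\in\mathbb{R}$ the sequence $(\alpha x_n)_{n\ge1}$ has Poissonian pair correlation, meaning that for every $s>0$ $$\lim_{N\to\infty}\frac1N\,\Bigl|\Bigl\{(n_1,n_2):\ 1\le n_1\ne n_2\le N,\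 \|\alpha x_{n_1}-\alpha x_{n_2}\|\le \frac sN\Bigr\}\Bigr| = 2s,$$ where $\|t\|$ denotes the distance from the real number $t$ to the nearest integer. -/

import Mathlib

open Filter Topology MeasureTheory Asymptotics

/-- The distance `‖t‖` from a real number `t` to the nearest integer. -/
noncomputable def distNearestInt (t : ℝ) : ℝ := |t - (round t : ℝ)|

open Classical in
/-- The number of ordered pairs `1 ≤ n₁ ≠ n₂ ≤ N` with `‖y n₁ - y n₂‖ ≤ s / N`.
Sequences are indexed by the integers `n ≥ 1`; the value at `0` is never used. -/
noncomputable def pairCount (y : ℕ → ℝ) (s : ℝ) (N : ℕ) : ℕ :=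
  ((Finset.Icc 1 N ×ˢ Finset.Icc 1 N).filter
    (fun p : ℕ × ℕ => p.1 ≠ p.2 ∧ distNearestInt (y p.1 - y p.2) ≤ s / (N : ℝ))).card

/-- The sequence `(y n)_{n ≥ 1}` has Poissonian pair correlation. -/
def HasPoissonianPairCorrelation (y : ℕ → ℝ) : Prop :=
  ∀ s : ℝ, 0 < s →
    Tendsto (fun N : ℕ => (1 / (N : ℝ)) * (pairCount y s N : ℝ)) atTop (𝓝 (2 * s))

/-- The sequence `(x n)_{n ≥ 1}` is metric Poissonian: for Lebesgue-almost all real `α`,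
the sequence `(α x n)_{n ≥ 1}` has Poissonian pair correlation. -/
def IsMetricPoissonian (x : ℕ → ℝ) : Prop :=
  ∀ᵐ α : ℝ ∂volume, HasPoissonianPairCorrelation (fun n => α * x n)

open Classical in
/-- The approximate additive energy `E*_{N,γ}`: the number of quadruples
`1 ≤ n₁, n₂, n₃, n₄ ≤ N` with `|x n₁ - x n₂ + x n₃ - x n₄| < γ`. -/
noncomputable def approxEnergy (x : ℕ → ℝ) (N : ℕ) (γ : ℝ) : ℕ :=
  ((Finset.Icc 1 N ×ˢ Finset.Icc 1 N ×ˢ Finset.Icc 1 N ×ˢ Finset.Icc 1 N).filter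
    (fun q : ℕ × ℕ × ℕ × ℕ => |x q.1 - x q.2.1 + x q.2.2.1 - x q.2.2.2| < γ)).card

open Classical in
/-- The sum of `1 / √(x n₂ - x n₁)` over `1 ≤ n₁ < n₂ ≤ N` with `x n₂ - x n₁ ≥ 1`. -/
noncomputable def gapSum (x : ℕ → ℝ) (N : ℕ) : ℝ :=
  ∑ p ∈ (Finset.Icc 1 N ×ˢ Finset.Icc 1 N).filter
    (fun p : ℕ × ℕ => p.1 < p.2 ∧ 1 ≤ x p.2 - x p.1), 1 / Real.sqrt (x p.2 - x p.1)

/-! Smooth the pair count by a bump `b` of width about `1 / N` and expand by Poisson summation. The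
zero frequency contributes `(1 - 1/N) ∫ b`. The frequencies `0 < |k| ≤ K = N ^ (1 + ε)` form an
exponential sum in `α` with coefficients `O(1/N)` and frequencies `k (x m - x n)`; the tail is
negligible. Its mean square against `exp (-π α²)` is at most a constant times `N⁻²` times the number
`Q` of solutions of `|k z - l w| < 1`, where `k, l ≤ K` and `z, w` run over the positive gaps of `x`
up to index `K` (`integral_gaussian_mul_norm_expSum_sq_le`, `nearPairs_signed_le`). After the
normalisation `1 / N`, a bound `Q(N) ≪ N ^ (4 - τ)` makes the variances summable along `N = m ^ P`.
This gives almost everywhere convergence on that subsequence, and monotonicity of the pair count in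
`N` fills the holes (`hasPoissonianPairCorrelation_of_tendsto_bumpStat`).

The heart is the bound for `Q`. Gaps below one are handled trivially by the spacing hypothesis
(`stripCount_le_of_lt_one`, `sum_inv_gap_le`). For gaps at least one, `ratioCount_sq_le` shows, up
to logarithms and divisor functions, `Q² ≪ N E (N² G² + N⁴ + Q)`, where `E` is the additive energy
and `G` the sum of the inverse square roots of the gaps. With `E ≪ N ^ (3 - κ - δ)` and `G ≪ N ^ (1
+ κ/2)` the powers of `κ` cancel and a power is saved.

To prove this inequality, restrict to `l` of size `L` and divide by `l`: `k z / l` lies within `1 /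
L` of `w`. Cauchy–Schwarz over cells of length `1 / L` separates the two sides. The `w` side is
bounded by `(N / L) E`. On the other side two ratios share a cell only if `|k l' z - k' l z'| < 4
L`, so by the divisor bound it is controlled by lattice points `(r, s)` with `r, s ≤ 4 L²` and `|r z
- s z'| < 4 L`. Such a strip contains at most about its area many points, plus a term governed by
the multiples of one primitive vector (`stripCount_le`). Contracting these multiples by the factor
`4 L` turns them into solutions counted by `Q` itself, which is why `Q` reappears on the right. -/

/-! ### Lattice points in thin strips -/

/-- Integer vectors with vanishing determinant against a primitive vector are its multiples. -/
lemma exists_int_mul_of_det_eq_zero {a b r s : ℤ} (h : IsCoprime a b) (hd : a * s = b * r) :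
    ∃ m : ℤ, r = m * a ∧ s = m * b := by
  obtain ⟨p, q, hpq⟩ := h
  refine ⟨p * r + q * s, ?_, ?_⟩
  · linear_combination (-r) * hpq - q * hd
  · linear_combination (-s) * hpq + p * hd

/-- Gauge of the strip `|s| ≤ A`, `|r z - s w| ≤ B` in the plane. -/
noncomputable def stripGauge (A B z w : ℝ) (v : ℤ × ℤ) : ℝ :=
  max (|(v.2 : ℝ)| / A) (|v.1 * z - v.2 * w| / B)

lemma stripGauge_smul {A B z w : ℝ} (m a b : ℤ) :
    stripGauge A B z w (m * a, m * b) = |(m : ℝ)| * stripGauge A B z w (a, b) := by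
  unfold stripGauge
  rw [mul_max_of_nonneg _ _ (abs_nonneg _)]
  congr 1
  · push_cast; rw [abs_mul, mul_div_assoc]
  · push_cast
    rw [show (m : ℝ) * a * z - m * b * w = m * (a * z - b * w) by ring, abs_mul, mul_div_assoc]

lemma stripGauge_nonneg {A B z w : ℝ} (hA : 0 < A) (v : ℤ × ℤ) : 0 ≤ stripGauge A B z w v :=
  le_max_of_le_left (by positivity)

lemma abs_snd_le_stripGauge {A B z w : ℝ} (hA : 0 < A) (v : ℤ × ℤ) :
    |(v.2 : ℝ)| ≤ A * stripGauge A B z w v := by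
  have h : |(v.2 : ℝ)| / A ≤ stripGauge A B z w v := le_max_left _ _
  rwa [div_le_iff₀' hA] at h

lemma abs_sub_le_stripGauge {A B z w : ℝ} (hB : 0 < B) (v : ℤ × ℤ) :
    |v.1 * z - v.2 * w| ≤ B * stripGauge A B z w v := by
  have h : |v.1 * z - v.2 * w| / B ≤ stripGauge A B z w v := le_max_right _ _
  rwa [div_le_iff₀' hB] at h

lemma stripGauge_pos {A B z w : ℝ} (hA : 0 < A) (hB : 0 < B) (hz : 0 < z) {v : ℤ × ℤ}
    (hv : v ≠ 0) : 0 < stripGauge A B z w v := by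
  rcases (stripGauge_nonneg hA v).lt_or_eq with h | h
  · exact h
  exfalso
  have h1 := abs_snd_le_stripGauge (B := B) (z := z) (w := w) hA v
  have h2 := abs_sub_le_stripGauge (A := A) (z := z) (w := w) hB v
  rw [← h, mul_zero] at h1 h2
  have h3 : (v.2 : ℝ) = 0 := abs_eq_zero.1 (le_antisymm h1 (abs_nonneg _))
  rw [h3, zero_mul, sub_zero] at h2
  have h4 : (v.1 : ℝ) * z = 0 := abs_eq_zero.1 (le_antisymm h2 (abs_nonneg _))
  have h5 : (v.1 : ℝ) = 0 := by
    rcases mul_eq_zero.1 h4 with h | h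
    · exact h
    · exact absurd h hz.ne'
  exact hv (Prod.ext (by exact_mod_cast h5) (by exact_mod_cast h3))

lemma stripGauge_sub_le {A B z w : ℝ} (hA : 0 < A) (hB : 0 < B) (v v' : ℤ × ℤ) :
    stripGauge A B z w (v - v') ≤ stripGauge A B z w v + stripGauge A B z w v' := by
  refine max_le ?_ ?_
  · rw [div_le_iff₀' hA, mul_add]
    refine le_trans ?_ (add_le_add (abs_snd_le_stripGauge hA v) (abs_snd_le_stripGauge hA v'))
    push_cast [Prod.snd_sub]
    exact abs_sub _ _
  · rw [div_le_iff₀' hB, mul_add]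
    refine le_trans ?_ (add_le_add (abs_sub_le_stripGauge hB v) (abs_sub_le_stripGauge hB v'))
    push_cast [Prod.snd_sub, Prod.fst_sub]
    rw [show ((v.1 : ℝ) - v'.1) * z - (v.2 - v'.2) * w
      = (v.1 * z - v.2 * w) - (v'.1 * z - v'.2 * w) by ring]
    exact abs_sub _ _

/-- Among the nonzero integer vectors of gauge at most one there is a primitive one of
least gauge. -/
lemma exists_primitive_min_stripGauge {A B z w : ℝ} (hA : 0 < A) (hB : 0 < B) (hz : 0 < z)
    (hne : ∃ v : ℤ × ℤ, v ≠ 0 ∧ stripGauge A B z w v ≤ 1) :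
    ∃ u : ℤ × ℤ, u ≠ 0 ∧ stripGauge A B z w u ≤ 1 ∧ IsCoprime u.1 u.2 ∧
      ∀ v : ℤ × ℤ, v ≠ 0 → stripGauge A B z w u ≤ stripGauge A B z w v := by
  set g := stripGauge A B z w with hg
  set S : Set (ℤ × ℤ) := {v | v ≠ 0 ∧ g v ≤ 1} with hS
  have hfin : S.Finite := by
    refine Set.Finite.subset ((Set.finite_Icc (-⌈(B + A * |w|) / z⌉) ⌈(B + A * |w|) / z⌉).prod
      (Set.finite_Icc (-⌈A⌉) ⌈A⌉)) ?_
    rintro v ⟨-, hv⟩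
    have h1 := abs_snd_le_stripGauge (B := B) (z := z) (w := w) hA v
    have h2 := abs_sub_le_stripGauge (A := A) (z := z) (w := w) hB v
    have h1' : |(v.2 : ℝ)| ≤ A := h1.trans (mul_le_of_le_one_right hA.le hv)
    have h2' := h2.trans (mul_le_of_le_one_right hB.le hv)
    have h3 : |(v.1 : ℝ)| ≤ (B + A * |w|) / z := by
      rw [le_div_iff₀ hz]
      calc |(v.1 : ℝ)| * z = |(v.1 : ℝ) * z| := by rw [abs_mul, abs_of_pos hz]
        _ = |(v.1 * z - v.2 * w) + v.2 * w| := by ring_nf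
        _ ≤ |v.1 * z - v.2 * w| + |v.2 * w| := abs_add_le _ _
        _ ≤ B + A * |w| := by rw [abs_mul]; gcongr
    have h4 := abs_le.1 (h3.trans (Int.le_ceil _))
    have h5 := abs_le.1 (h1'.trans (Int.le_ceil _))
    refine ⟨⟨?_, ?_⟩, ⟨?_, ?_⟩⟩
    · exact_mod_cast h4.1
    · exact_mod_cast h4.2
    · exact_mod_cast h5.1
    · exact_mod_cast h5.2
  obtain ⟨v, hv, hmin⟩ := Set.exists_min_image S g hfin hne
  have hmin' : ∀ v' : ℤ × ℤ, v' ≠ 0 → g v ≤ g v' := fun v' hv' => by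
    by_cases h : g v' ≤ 1
    · exact hmin v' ⟨hv', h⟩
    · exact hv.2.trans (not_le.1 h).le
  -- Dividing the minimiser by the gcd of its coordinates makes it primitive and cannot increase the
  -- gauge.
  have hd : 0 < Int.gcd v.1 v.2 := by
    rw [Int.gcd_pos_iff]
    by_contra! h
    exact hv.1 (Prod.ext h.1 h.2)
  obtain ⟨a, b, hab, ha, hb⟩ := Int.exists_gcd_one hd
  have hva : v = ((Int.gcd v.1 v.2 : ℤ) * a, (Int.gcd v.1 v.2 : ℤ) * b) :=
    Prod.ext (ha.trans (mul_comm _ _)) (hb.trans (mul_comm _ _))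
  have hle : g (a, b) ≤ g v := by
    have h : g v = |((Int.gcd v.1 v.2 : ℤ) : ℝ)| * g (a, b) := by
      conv_lhs => rw [hva]
      exact stripGauge_smul _ _ _
    rw [h]
    refine le_mul_of_one_le_left (stripGauge_nonneg hA _) ?_
    rw [Int.cast_natCast, Nat.abs_cast]
    exact_mod_cast hd
  refine ⟨(a, b), ?_, hle.trans hv.2, Int.isCoprime_iff_gcd_eq_one.2 hab,
    fun v' hv' => hle.trans (hmin' v' hv')⟩
  intro h
  rw [Prod.mk_eq_zero] at h
  rw [h.1, h.2] at hva
  exact hv.1 (hva.trans (by simp))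

/-- Number of `1 ≤ r, s ≤ M` with `|r z - s w| < T`. -/
noncomputable def stripCount (M : ℕ) (T z w : ℝ) : ℕ :=
  ((Finset.Icc 1 M ×ˢ Finset.Icc 1 M).filter
    (fun p : ℕ × ℕ => |(p.1 : ℝ) * z - p.2 * w| < T)).card

lemma stripGauge_neg {A B z w : ℝ} (v : ℤ × ℤ) :
    stripGauge A B z w (-v) = stripGauge A B z w v := by
  have h := stripGauge_smul (A := A) (B := B) (z := z) (w := w) (-1) v.1 v.2
  simp only [Int.reduceNeg, neg_mul, one_mul, Int.cast_neg, Int.cast_one, abs_neg, abs_one] at h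
  exact h

/-- If `u` has small gauge `μ`, the multiples `m u` with `m ≤ 1 / (8 L μ)` all lie in the strip
contracted by `4 L`, so a short vector forces many solutions of `|r z - s w| < 1`. -/
lemma inv_stripGauge_le {L N : ℕ} (hL : 1 ≤ L) (hLN : L ≤ N) {z w : ℝ} (hw : 1 ≤ w)
    (hwz : w ≤ z) {u : ℤ × ℤ} (hu : u ≠ 0) :
    (stripGauge (4 * L ^ 2) (4 * L) z w u)⁻¹ ≤ 8 * L * (stripCount N 1 z w + 1) := by
  have hL0 : (1 : ℝ) ≤ L := by exact_mod_cast hL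
  have hLN' : (L : ℝ) ≤ N := by exact_mod_cast hLN
  have hA : (0 : ℝ) < 4 * L ^ 2 := by positivity
  have hB : (0 : ℝ) < 4 * L := by positivity
  have hz : 0 < z := by linarith
  wlog hs : 0 ≤ u.2 generalizing u
  · have h := this (u := -u) (neg_ne_zero.2 hu) (by simp; omega)
    rwa [stripGauge_neg] at h
  have h1 := abs_snd_le_stripGauge (B := 4 * L) (z := z) (w := w) hA u
  have h2 := abs_sub_le_stripGauge (A := 4 * L ^ 2) (z := z) (w := w) hB u
  have hμ0 : 0 < stripGauge (4 * L ^ 2) (4 * L) z w u := stripGauge_pos hA hB hz hu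
  generalize stripGauge (4 * (L : ℝ) ^ 2) (4 * L) z w u = μ at *
  have key : ⌊(8 * L * μ)⁻¹⌋₊ ≤ stripCount N 1 z w := by
    have hcard : ⌊(8 * L * μ)⁻¹⌋₊ = (Finset.Icc 1 ⌊(8 * L * μ)⁻¹⌋₊).card := by simp
    rw [hcard]
    unfold stripCount
    have hm : ∀ m ∈ Finset.Icc 1 ⌊(8 * L * μ)⁻¹⌋₊, 0 < m ∧ (m : ℝ) * (L * μ) ≤ 1 / 8 := by
      intro m hm
      rw [Finset.mem_Icc] at hm
      refine ⟨hm.1, ?_⟩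
      have h3 := (Nat.le_floor_iff (by positivity)).1 hm.2
      rw [le_inv_comm₀ (by exact_mod_cast hm.1) (by positivity)] at h3
      have hm0 : (0 : ℝ) < m := by exact_mod_cast hm.1
      calc (m : ℝ) * (L * μ) = m * (8 * L * μ) / 8 := by ring
        _ ≤ m * (m : ℝ)⁻¹ / 8 := by gcongr
        _ = 1 / 8 := by rw [mul_inv_cancel₀ hm0.ne']
    rcases Finset.eq_empty_or_nonempty (Finset.Icc 1 ⌊(8 * L * μ)⁻¹⌋₊) with he | ⟨m₁, hm₁⟩
    · rw [he]; simp
    have hsmall : (L : ℝ) * μ ≤ 1 / 8 := by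
      obtain ⟨h3, h4⟩ := hm m₁ hm₁
      have : (1 : ℝ) ≤ m₁ := by exact_mod_cast h3
      nlinarith [mul_pos (by linarith : (0 : ℝ) < L) hμ0]
    -- The constant 8, twice the contraction factor 4, gives `1 / 2` here. As `1 ≤ w ≤ z` and `0 ≤
    -- u.2`, this forces `1 ≤ u.1 ≤ u.2`, so all the multiples have positive coordinates and only
    -- the second one must be bounded by `N`.
    have h2' : |u.1 * z - u.2 * w| ≤ 1 / 2 := h2.trans (by linarith)
    have hs' : (0 : ℝ) ≤ u.2 := by exact_mod_cast hs
    have hr1 : 1 ≤ u.1 := by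
      by_contra! h
      have hr : (u.1 : ℝ) ≤ 0 := by exact_mod_cast (by omega : u.1 ≤ 0)
      have h5 := (abs_le.1 h2').1
      have h6 : (u.2 : ℝ) = 0 := by
        by_contra h0
        have : (1 : ℝ) ≤ u.2 := by
          have : u.2 ≠ 0 := by exact_mod_cast h0
          exact_mod_cast (by omega : 1 ≤ u.2)
        nlinarith
      have h7 : (u.1 : ℝ) = 0 := by
        by_contra h0
        have : (u.1 : ℝ) ≤ -1 := by
          have : u.1 ≠ 0 := by exact_mod_cast h0
          exact_mod_cast (by omega : u.1 ≤ -1)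
        rw [h6] at h5
        nlinarith
      exact hu (Prod.ext (by exact_mod_cast h7) (by exact_mod_cast h6))
    have hrs : u.1 ≤ u.2 := by
      by_contra! h
      have h8 : (u.2 : ℝ) + 1 ≤ u.1 := by exact_mod_cast h
      have h5 := (abs_le.1 h2').2
      nlinarith
    have hs1 : 1 ≤ u.2 := hr1.trans hrs
    refine Finset.card_le_card_of_injOn (fun m => (m * u.1.toNat, m * u.2.toNat)) ?_ ?_
    · intro m hmem
      obtain ⟨hm0, hm8⟩ := hm m hmem
      have hr : ((u.1.toNat : ℕ) : ℝ) = u.1 := by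
        rw [← Int.cast_natCast, Int.toNat_of_nonneg (by omega)]
      have hs2 : ((u.2.toNat : ℕ) : ℝ) = u.2 := by
        rw [← Int.cast_natCast, Int.toNat_of_nonneg (by omega)]
      have hb : m * u.2.toNat ≤ N := by
        have : ((m * u.2.toNat : ℕ) : ℝ) ≤ N := by
          push_cast
          rw [hs2]
          rw [abs_of_nonneg hs'] at h1
          calc (m : ℝ) * u.2 ≤ m * (4 * L ^ 2 * μ) := by gcongr
            _ = 4 * L * (m * (L * μ)) := by ring
            _ ≤ 4 * L * (1 / 8) := by gcongr
            _ ≤ N := by linarith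
        exact_mod_cast this
      have hle : u.1.toNat ≤ u.2.toNat := by omega
      have h1r : 1 ≤ u.1.toNat := by omega
      simp only [Finset.coe_filter, Set.mem_ofPred_eq, Finset.mem_product, Finset.mem_Icc]
      refine ⟨⟨⟨Nat.mul_pos hm0 h1r, (Nat.mul_le_mul_left m hle).trans hb⟩,
        ⟨Nat.mul_pos hm0 (h1r.trans hle), hb⟩⟩, ?_⟩
      push_cast
      rw [hr, hs2, show (m : ℝ) * u.1 * z - m * u.2 * w = m * (u.1 * z - u.2 * w) by ring,
        abs_mul, Nat.abs_cast]
      calc (m : ℝ) * |u.1 * z - u.2 * w| ≤ m * (4 * L * μ) := by gcongr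
        _ = 4 * (m * (L * μ)) := by ring
        _ < 1 := by linarith
    · intro m _ m' _ h
      simp only [Prod.mk.injEq] at h
      exact Nat.eq_of_mul_eq_mul_right (by omega) h.1
  have h3 : (8 * L * μ)⁻¹ ≤ stripCount N 1 z w + 1 := by
    refine (Nat.lt_floor_add_one _).le.trans ?_
    have : ((⌊(8 * L * μ)⁻¹⌋₊ : ℕ) : ℝ) ≤ stripCount N 1 z w := by exact_mod_cast key
    linarith
  calc μ⁻¹ = 8 * L * (8 * L * μ)⁻¹ := by field_simp
    _ ≤ _ := by gcongr

/-- Counting integer points in a thin strip of length `4 L ^ 2` by its area and by the number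
of integer points in the strip contracted by `4 L`. -/
lemma stripCount_le {L N : ℕ} (hL : 1 ≤ L) (hLN : L ≤ N) {z w : ℝ} (hw : 1 ≤ w)
    (hwz : w ≤ z) :
    (stripCount (4 * L ^ 2) (4 * L) z w : ℝ)
      ≤ 320 * L ^ 3 / z + 40 * L * (stripCount N 1 z w + 1) := by
  classical
  have hL0 : (1 : ℝ) ≤ L := by exact_mod_cast hL
  have hA : (0 : ℝ) < 4 * L ^ 2 := by positivity
  have hB : (0 : ℝ) < 4 * L := by positivity
  have hz : 0 < z := by linarith
  set B := ((Finset.Icc 1 (4 * L ^ 2) ×ˢ Finset.Icc 1 (4 * L ^ 2)).filter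
    (fun p : ℕ × ℕ => |(p.1 : ℝ) * z - p.2 * w| < 4 * L)) with hBdef
  have hcount : stripCount (4 * L ^ 2) (4 * L) z w = B.card := rfl
  rw [hcount]
  rcases B.eq_empty_or_nonempty with he | ⟨p₀, hp₀⟩
  · rw [he]; simp only [Finset.card_empty, Nat.cast_zero]; positivity
  set c : ℕ × ℕ → ℤ × ℤ := fun p => ((p.1 : ℤ), (p.2 : ℤ)) with hc
  have hmemB : ∀ p ∈ B, 0 < p.1 ∧ stripGauge (4 * L ^ 2) (4 * L) z w (c p) ≤ 1 := by
    intro p hp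
    simp only [hBdef, Finset.mem_filter, Finset.mem_product, Finset.mem_Icc] at hp
    refine ⟨hp.1.1.1, max_le ?_ ?_⟩
    · rw [div_le_one hA]
      simp only [hc, Int.cast_natCast, Nat.abs_cast]
      exact_mod_cast hp.1.2.2
    · rw [div_le_one hB]
      simp only [hc, Int.cast_natCast]
      exact hp.2.le
  obtain ⟨u, hu0, hu1, hcop, hmin⟩ := exists_primitive_min_stripGauge (w := w) hA hB hz
    ⟨c p₀, fun h => by
      have h1 := (hmemB p₀ hp₀).1
      have h2 := congrArg Prod.fst h
      simp only [hc, Prod.fst_zero] at h2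
      omega, (hmemB p₀ hp₀).2⟩
  have hinv := inv_stripGauge_le hL hLN hw hwz hu0
  have hμ0 := stripGauge_pos (w := w) hA hB hz hu0
  have h1 := abs_snd_le_stripGauge (B := 4 * L) (z := z) (w := w) hA u
  have h2 := abs_sub_le_stripGauge (A := 4 * L ^ 2) (z := z) (w := w) hB u
  set μ := stripGauge (4 * (L : ℝ) ^ 2) (4 * L) z w u with hμ
  -- The points are sorted by their determinant against `u`, that is by the lines parallel to `u`:
  -- `X` bounds the determinant, and `Y` bounds the multiple of `u` separating two points on one
  -- line, since their difference has gauge at most 2.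
  set X : ℤ := ⌊32 * L ^ 3 * μ / z⌋ with hX
  set Y : ℤ := ⌊2 / μ⌋ with hY
  have hX0 : 0 ≤ X := Int.floor_nonneg.2 (by positivity)
  have hY0 : 0 ≤ Y := Int.floor_nonneg.2 (by positivity)
  have hdet : ∀ p ∈ B, u.1 * (p.2 : ℤ) - u.2 * (p.1 : ℤ) ∈ Finset.Icc (-X) X := by
    intro p hp
    have hg := (hmemB p hp).2
    have h3 := (abs_snd_le_stripGauge (B := 4 * L) (z := z) (w := w) hA (c p)).trans
      (mul_le_of_le_one_right hA.le hg)
    have h4 := (abs_sub_le_stripGauge (A := 4 * L ^ 2) (z := z) (w := w) hB (c p)).trans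
      (mul_le_of_le_one_right hB.le hg)
    simp only [hc, Int.cast_natCast] at h3 h4
    have h5 : |((u.1 * (p.2 : ℤ) - u.2 * (p.1 : ℤ) : ℤ) : ℝ)| ≤ 32 * L ^ 3 * μ / z := by
      rw [le_div_iff₀ hz]
      calc |((u.1 * (p.2 : ℤ) - u.2 * (p.1 : ℤ) : ℤ) : ℝ)| * z
          = |((u.1 * (p.2 : ℤ) - u.2 * (p.1 : ℤ) : ℤ) : ℝ) * z| := by
            rw [abs_mul, abs_of_pos hz]
        _ = |(u.1 * z - u.2 * w) * p.2 - u.2 * (p.1 * z - p.2 * w)| := by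
            congr 1; push_cast; ring
        _ ≤ |u.1 * z - u.2 * w| * |(p.2 : ℝ)| + |(u.2 : ℝ)| * |p.1 * z - p.2 * w| := by
            rw [← abs_mul, ← abs_mul]; exact abs_sub _ _
        _ ≤ (4 * L * μ) * (4 * L ^ 2) + (4 * L ^ 2 * μ) * (4 * L) := by gcongr
        _ = 32 * L ^ 3 * μ := by ring
    have h6 := abs_le.1 h5
    rw [Finset.mem_Icc]
    refine ⟨?_, Int.le_floor.2 h6.2⟩
    have : -(u.1 * (p.2 : ℤ) - u.2 * (p.1 : ℤ)) ≤ X := Int.le_floor.2 (by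
      push_cast at h6 ⊢; linarith [h6.1])
    linarith
  have hfib : ∀ d ∈ Finset.Icc (-X) X,
      (B.filter (fun p => u.1 * (p.2 : ℤ) - u.2 * (p.1 : ℤ) = d)).card
        ≤ (Finset.Icc (-Y) Y).card := by
    intro d _
    rcases (B.filter (fun p => u.1 * (p.2 : ℤ) - u.2 * (p.1 : ℤ) = d)).eq_empty_or_nonempty
      with he | ⟨p₁, hp₁⟩
    · rw [he]; simp
    rw [Finset.mem_filter] at hp₁
    have hex : ∀ p : ℕ × ℕ, ∃ m : ℤ,
        p ∈ B.filter (fun p => u.1 * (p.2 : ℤ) - u.2 * (p.1 : ℤ) = d) →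
        (p.1 : ℤ) - p₁.1 = m * u.1 ∧ (p.2 : ℤ) - p₁.2 = m * u.2 := by
      intro p
      by_cases hp : p ∈ B.filter (fun p => u.1 * (p.2 : ℤ) - u.2 * (p.1 : ℤ) = d)
      · have hp' := (Finset.mem_filter.1 hp).2
        obtain ⟨m, hm⟩ := exists_int_mul_of_det_eq_zero (r := (p.1 : ℤ) - p₁.1)
          (s := (p.2 : ℤ) - p₁.2) hcop (by linear_combination hp' - hp₁.2)
        exact ⟨m, fun _ => hm⟩
      · exact ⟨0, fun h => absurd h hp⟩
    choose m hm using hex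
    refine Finset.card_le_card_of_injOn m ?_ ?_
    · intro p hp
      obtain ⟨hm1, hm2⟩ := hm p hp
      have hpB := (hmemB p (Finset.mem_filter.1 hp).1).2
      have hsub := stripGauge_sub_le (z := z) (w := w) hA hB (c p) (c p₁)
      have heq : c p - c p₁ = (m p * u.1, m p * u.2) := Prod.ext hm1 hm2
      rw [heq, stripGauge_smul] at hsub
      have h7 : |(m p : ℝ)| * μ ≤ 2 := by
        have := (hmemB p₁ hp₁.1).2
        calc |(m p : ℝ)| * μ ≤ _ := hsub
          _ ≤ 2 := by linarith
      have h8 := abs_le.1 ((le_div_iff₀ hμ0).2 h7)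
      rw [Finset.mem_coe, Finset.mem_Icc]
      refine ⟨?_, Int.le_floor.2 h8.2⟩
      have : -(m p) ≤ Y := Int.le_floor.2 (by push_cast; linarith [h8.1])
      linarith
    · intro p hp p' hp' h
      obtain ⟨hm1, hm2⟩ := hm p hp
      obtain ⟨hm1', hm2'⟩ := hm p' hp'
      rw [h] at hm1 hm2
      exact Prod.ext (by omega) (by omega)
  have hcard := Finset.card_le_mul_card_image_of_maps_to hdet _ hfib
  rw [Int.card_Icc, Int.card_Icc] at hcard
  have hcard' : (B.card : ℝ) ≤ (2 * Y + 1) * (2 * X + 1) := by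
    have : (B.card : ℤ) ≤ (2 * Y + 1) * (2 * X + 1) := by
      have e1 : ((Y + 1 - -Y).toNat : ℤ) = 2 * Y + 1 := by omega
      have e2 : ((X + 1 - -X).toNat : ℤ) = 2 * X + 1 := by omega
      rw [← e1, ← e2]
      exact_mod_cast hcard
    exact_mod_cast this
  have hXr : (X : ℝ) ≤ 32 * L ^ 3 * μ / z := Int.floor_le _
  have hYr : (Y : ℝ) ≤ 2 / μ := Int.floor_le _
  have hX0' : (0 : ℝ) ≤ X := by exact_mod_cast hX0
  -- The gauge bound `μ ≤ 1` absorbs the summand 1.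
  have hY1 : 2 * (Y : ℝ) + 1 ≤ 5 / μ := by
    have : 1 ≤ 1 / μ := by rw [le_div_iff₀ hμ0]; linarith
    calc 2 * (Y : ℝ) + 1 ≤ 2 * (2 / μ) + 1 / μ := by linarith
      _ = 5 / μ := by ring
  calc (B.card : ℝ) ≤ (2 * Y + 1) * (2 * X + 1) := hcard'
    _ ≤ 5 / μ * (2 * (32 * L ^ 3 * μ / z) + 1) := by gcongr
    _ = 320 * L ^ 3 / z + 5 * μ⁻¹ := by field_simp; ring
    _ ≤ 320 * L ^ 3 / z + 5 * (8 * L * (stripCount N 1 z w + 1)) := by gcongr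
    _ = _ := by ring

/-! ### Coincidence counts and Cauchy–Schwarz -/

/-- Number of pairs in `S × T` on which `f` and `g` agree. -/
def coincidences {α β γ : Type*} [DecidableEq γ] (S : Finset α) (T : Finset β) (f : α → γ)
    (g : β → γ) : ℕ :=
  ((S ×ˢ T).filter (fun p : α × β => f p.1 = g p.2)).card

lemma coincidences_eq_sum {α β γ : Type*} [DecidableEq γ] (S : Finset α) (T : Finset β)
    (f : α → γ) (g : β → γ) (C : Finset γ) (hC : ∀ a ∈ S, f a ∈ C) :
    coincidences S T f g
      = ∑ c ∈ C, (S.filter (fun a => f a = c)).card * (T.filter (fun b => g b = c)).card := by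
  unfold coincidences
  rw [Finset.card_eq_sum_card_fiberwise (f := fun p : α × β => f p.1) (t := C)]
  · refine Finset.sum_congr rfl fun c _ => ?_
    rw [← Finset.card_product]
    congr 1
    ext ⟨a, b⟩
    simp only [Finset.mem_filter, Finset.mem_product]
    constructor
    · rintro ⟨⟨⟨h1, h2⟩, h3⟩, h4⟩
      exact ⟨⟨h1, h4⟩, h2, h3 ▸ h4⟩
    · rintro ⟨⟨h1, h4⟩, h2, h3⟩
      exact ⟨⟨⟨h1, h2⟩, h4.trans h3.symm⟩, h4⟩
  · intro p hp
    exact hC _ (Finset.mem_product.1 (Finset.mem_filter.1 hp).1).1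

/-- Cauchy–Schwarz for the fibre sizes of `f` and `g` over their common range. -/
lemma coincidences_sq_le {α β γ : Type*} [DecidableEq γ] (S : Finset α) (T : Finset β)
    (f : α → γ) (g : β → γ) :
    coincidences S T f g ^ 2 ≤ coincidences S S f f * coincidences T T g g := by
  rw [coincidences_eq_sum S T f g (S.image f ∪ T.image g)
      (fun a ha => Finset.mem_union_left _ (Finset.mem_image_of_mem f ha)),
    coincidences_eq_sum S S f f (S.image f ∪ T.image g)
      (fun a ha => Finset.mem_union_left _ (Finset.mem_image_of_mem f ha)),
    coincidences_eq_sum T T g g (S.image f ∪ T.image g)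
      (fun b hb => Finset.mem_union_right _ (Finset.mem_image_of_mem g hb))]
  simp only [← sq]
  exact Finset.sum_mul_sq_le_sq_mul_sq _ _ _

/-- Replacing `f` by `h` when every fibre of `f` meets at most `B` fibres of `h`. -/
lemma coincidences_le_mul {α γ δ : Type*} [DecidableEq γ] [DecidableEq δ] (S : Finset α)
    (f : α → γ) (h : α → δ) (B : ℕ)
    (hB : ∀ c, ((S.filter (fun a => f a = c)).image h).card ≤ B) :
    coincidences S S f f ≤ B * coincidences S S h h := by
  classical
  rw [coincidences_eq_sum S S f f (S.image f) (fun a ha => Finset.mem_image_of_mem f ha)]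
  -- Cauchy–Schwarz for the decomposition of `F` into the fibres of `h`.
  have hfib : ∀ F : Finset α, F.card ^ 2 ≤ (F.image h).card * coincidences F F h h := by
    intro F
    rw [coincidences_eq_sum F F h h (F.image h) (fun a ha => Finset.mem_image_of_mem h ha)]
    simp only [← sq]
    rw [Finset.card_eq_sum_card_fiberwise (f := h) (t := F.image h)
      (fun a ha => Finset.mem_image_of_mem h ha)]
    exact sq_sum_le_card_mul_sum_sq
  have hdisj : ∑ c ∈ S.image f, coincidences (S.filter (fun a => f a = c))
      (S.filter (fun a => f a = c)) h h ≤ coincidences S S h h := by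
    unfold coincidences
    rw [← Finset.card_biUnion]
    · refine Finset.card_le_card fun p hp => ?_
      simp only [Finset.mem_biUnion, Finset.mem_filter, Finset.mem_product] at hp ⊢
      obtain ⟨c, -, ⟨⟨h1, -⟩, h2, -⟩, h3⟩ := hp
      exact ⟨⟨h1, h2⟩, h3⟩
    · intro c _ c' _ hcc
      refine Finset.disjoint_left.2 fun p hp hp' => hcc ?_
      simp only [Finset.mem_filter, Finset.mem_product] at hp hp'
      exact hp.1.1.2.symm.trans hp'.1.1.2
  calc ∑ c ∈ S.image f, (S.filter (fun a => f a = c)).card * (S.filter (fun a => f a = c)).card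
      ≤ ∑ c ∈ S.image f, B * coincidences (S.filter (fun a => f a = c))
          (S.filter (fun a => f a = c)) h h := by
        refine Finset.sum_le_sum fun c _ => ?_
        rw [← sq]
        exact (hfib _).trans (Nat.mul_le_mul_right _ (hB c))
    _ ≤ B * coincidences S S h h := by
        rw [← Finset.mul_sum]; exact Nat.mul_le_mul_left _ hdisj

/-- The integers `f` and `g` differ by -1, 0 or 1. Shifting `g` leaves its self-coincidences
unchanged, so Cauchy–Schwarz bounds each of the three cases alike, and squaring a sum of three gives
the 9. -/
lemma card_near_sq_le {α β : Type*} (S : Finset α) (T : Finset β) (f : α → ℤ) (g : β → ℤ) :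
    ((S ×ˢ T).filter (fun p : α × β => |f p.1 - g p.2| ≤ 1)).card ^ 2
      ≤ 9 * (coincidences S S f f * coincidences T T g g) := by
  classical
  have hsub : ((S ×ˢ T).filter (fun p : α × β => |f p.1 - g p.2| ≤ 1)).card
      ≤ coincidences S T f g + coincidences S T f (fun b => g b + 1)
        + coincidences S T f (fun b => g b - 1) := by
    unfold coincidences
    refine le_trans (Finset.card_le_card ?_) ((Finset.card_union_le _ _).trans
      (Nat.add_le_add_right (Finset.card_union_le _ _) _))
    intro p hp
    simp only [Finset.mem_union, Finset.mem_filter] at hp ⊢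
    obtain ⟨h1, h2⟩ := hp
    rw [abs_le] at h2
    have : f p.1 = g p.2 ∨ f p.1 = g p.2 + 1 ∨ f p.1 = g p.2 - 1 := by omega
    tauto
  have h0 := coincidences_sq_le S T f g
  have h1 := coincidences_sq_le S T f (fun b => g b + 1)
  have h2 := coincidences_sq_le S T f (fun b => g b - 1)
  have e1 : coincidences T T (fun b => g b + 1) (fun b => g b + 1) = coincidences T T g g := by
    unfold coincidences; simp
  have e2 : coincidences T T (fun b => g b - 1) (fun b => g b - 1) = coincidences T T g g := by
    unfold coincidences; simp
  rw [e1] at h1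
  rw [e2] at h2
  refine (Nat.pow_le_pow_left hsub 2).trans ?_
  generalize coincidences S T f g = x at *
  generalize coincidences S T f (fun b => g b + 1) = y at *
  generalize coincidences S T f (fun b => g b - 1) = w at *
  zify at *
  nlinarith [sq_nonneg ((x : ℤ) - y), sq_nonneg ((x : ℤ) - w), sq_nonneg ((y : ℤ) - w)]

/-- Number of pairs `(i, j)` in `I` with `|z i - z j| < γ`. -/
noncomputable def nearPairs {ι : Type*} (I : Finset ι) (z : ι → ℝ) (γ : ℝ) : ℕ :=
  ((I ×ˢ I).filter (fun p : ι × ι => |z p.1 - z p.2| < γ)).card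

lemma coincidences_floor_le_nearPairs {ι : Type*} (I : Finset ι) (z : ι → ℝ) {N : ℝ}
    (hN : 0 < N) :
    coincidences I I (fun i => ⌊N * z i⌋) (fun i => ⌊N * z i⌋) ≤ nearPairs I z (1 / N) := by
  refine Finset.card_le_card fun p hp => ?_
  simp only [Finset.mem_filter] at hp ⊢
  refine ⟨hp.1, ?_⟩
  have h := Int.abs_sub_lt_one_of_floor_eq_floor hp.2
  rw [← mul_sub, abs_mul, abs_of_pos hN] at h
  rwa [lt_div_iff₀' hN]

/-- A cell of length `1 / L` meets at most `N / L + 2 ≤ 3 N / L` cells of length `1 / N`, and two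
points in one of the latter form a near pair. -/
lemma coincidences_floor_le {ι : Type*} (I : Finset ι) (z : ι → ℝ) {L N : ℕ} (hL : 1 ≤ L)
    (hLN : L ≤ N) :
    (coincidences I I (fun i => ⌊(L : ℝ) * z i⌋) (fun i => ⌊(L : ℝ) * z i⌋) : ℝ)
      ≤ 3 * (N / L) * nearPairs I z (1 / N) := by
  have hL0 : (1 : ℝ) ≤ L := by exact_mod_cast hL
  have hLp : (0 : ℝ) < L := by linarith
  have hLN' : (L : ℝ) ≤ N := by exact_mod_cast hLN
  have h1 : 1 ≤ (N : ℝ) / L := by rw [le_div_iff₀ hLp]; linarith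
  have h := coincidences_le_mul I (fun i => ⌊(L : ℝ) * z i⌋) (fun i => ⌊(N : ℝ) * z i⌋)
    ⌊3 * ((N : ℝ) / L)⌋₊ ?_
  · have h2 := coincidences_floor_le_nearPairs I z (N := N) (by linarith)
    calc _ ≤ ((⌊3 * ((N : ℝ) / L)⌋₊ * coincidences I I (fun i => ⌊(N : ℝ) * z i⌋)
          (fun i => ⌊(N : ℝ) * z i⌋) : ℕ) : ℝ) := by exact_mod_cast h
      _ ≤ 3 * (N / L) * nearPairs I z (1 / N) := by
          push_cast
          gcongr
          exact Nat.floor_le (by positivity)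
  · intro c
    refine (Finset.card_le_card (t := Finset.Icc ⌊(N : ℝ) / L * c⌋ ⌊(N : ℝ) / L * (c + 1)⌋)
      ?_).trans ?_
    · intro d hd
      simp only [Finset.mem_image, Finset.mem_filter] at hd
      obtain ⟨i, ⟨-, hi⟩, rfl⟩ := hd
      rw [Int.floor_eq_iff] at hi
      rw [Finset.mem_Icc]
      have e : (N : ℝ) * z i = N / L * (L * z i) := by field_simp
      rw [e]
      exact ⟨Int.floor_le_floor (by gcongr; exact hi.1), Int.floor_le_floor
        (by gcongr; exact hi.2.le)⟩
    · rw [Int.card_Icc]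
      refine Nat.le_floor ?_
      have h2 : ⌊(N : ℝ) / L * c⌋ ≤ ⌊(N : ℝ) / L * (c + 1)⌋ :=
        Int.floor_le_floor (by gcongr; linarith)
      rw [← Int.cast_natCast, Int.toNat_of_nonneg (by omega)]
      push_cast
      have h3 := Int.floor_le ((N : ℝ) / L * (c + 1))
      have h4 := Int.lt_floor_add_one ((N : ℝ) / L * c)
      linarith

lemma stripCount_comm (M : ℕ) (T z w : ℝ) : stripCount M T z w = stripCount M T w z := by
  unfold stripCount
  refine Finset.card_bij (fun p _ => p.swap) ?_ ?_ ?_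
  · intro p hp
    simp only [Finset.mem_filter, Finset.mem_product, Prod.fst_swap, Prod.snd_swap] at hp ⊢
    exact ⟨⟨hp.1.2, hp.1.1⟩, by rw [abs_sub_comm]; exact hp.2⟩
  · intro p _ q _ h
    exact Prod.swap_injective h
  · intro p hp
    refine ⟨p.swap, ?_, p.swap_swap⟩
    simp only [Finset.mem_filter, Finset.mem_product, Prod.fst_swap, Prod.snd_swap] at hp ⊢
    exact ⟨⟨hp.1.2, hp.1.1⟩, by rw [abs_sub_comm]; exact hp.2⟩

/-- The area term involves the reciprocal of the larger of `z` and `w`. Bounding it by `1 / √(z w)`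
makes the sum over pairs factor into a square. -/
lemma stripCount_le_sqrt {L N : ℕ} (hL : 1 ≤ L) (hLN : L ≤ N) {z w : ℝ} (hz : 1 ≤ z)
    (hw : 1 ≤ w) :
    (stripCount (4 * L ^ 2) (4 * L) z w : ℝ)
      ≤ 320 * L ^ 3 * (1 / Real.sqrt z * (1 / Real.sqrt w))
        + 40 * L * (stripCount N 1 z w + 1) := by
  wlog hwz : w ≤ z generalizing z w
  · have h := this hw hz (not_le.1 hwz).le
    rwa [stripCount_comm, stripCount_comm N, mul_comm (1 / Real.sqrt w)] at h
  refine (stripCount_le hL hLN hw hwz).trans (add_le_add_left ?_ _)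
  rw [div_eq_mul_one_div]
  refine mul_le_mul_of_nonneg_left ?_ (by positivity)
  rw [one_div_mul_one_div, ← Real.sqrt_mul (by linarith)]
  refine one_div_le_one_div_of_le (Real.sqrt_pos.2 (by positivity)) ?_
  rw [Real.sqrt_le_left (by linarith)]
  nlinarith

/-! ### Dyadic blocks and the energy inequality -/

/-- Number of `1 ≤ k ≤ l`, `L ≤ l < 2 L` with `|k z - l w| < 1`. -/
noncomputable def blockCount (L : ℕ) (z w : ℝ) : ℕ :=
  ((Finset.Icc 1 (2 * L) ×ˢ Finset.Icc 1 (2 * L)).filter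
    (fun p : ℕ × ℕ => (p.1 ≤ p.2 ∧ L ≤ p.2 ∧ p.2 < 2 * L) ∧ |(p.1 : ℝ) * z - p.2 * w| < 1)).card

/-- Solutions are sorted by which coordinate is larger and by its dyadic size; exchanging `z` and
`w` reduces to `k ≤ l`. -/
lemma stripCount_le_sum_blockCount (N : ℕ) (z w : ℝ) :
    stripCount N 1 z w ≤ ∑ v ∈ Finset.range (Nat.log 2 N + 1),
      (blockCount (2 ^ v) z w + blockCount (2 ^ v) w z) := by
  classical
  have half : ∀ z w : ℝ, ((Finset.Icc 1 N ×ˢ Finset.Icc 1 N).filter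
      (fun p : ℕ × ℕ => p.1 ≤ p.2 ∧ |(p.1 : ℝ) * z - p.2 * w| < 1)).card
        ≤ ∑ v ∈ Finset.range (Nat.log 2 N + 1), blockCount (2 ^ v) z w := by
    intro z w
    rw [Finset.card_eq_sum_card_fiberwise (f := fun p : ℕ × ℕ => Nat.log 2 p.2)
      (t := Finset.range (Nat.log 2 N + 1))]
    · refine Finset.sum_le_sum fun v _ => Finset.card_le_card fun p hp => ?_
      simp only [Finset.mem_filter, Finset.mem_product, Finset.mem_Icc] at hp ⊢
      obtain ⟨⟨⟨⟨h1, h2⟩, h3, h4⟩, h5, h6⟩, h7⟩ := hp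
      have h8 : 2 ^ v ≤ p.2 := h7 ▸ Nat.pow_log_le_self 2 (by omega)
      have h9 : p.2 < 2 * 2 ^ v := by
        rw [← pow_succ', ← h7]
        exact Nat.lt_pow_succ_log_self (by norm_num) _
      exact ⟨⟨⟨h1, by omega⟩, h3, by omega⟩, ⟨h5, h8, h9⟩, h6⟩
    · intro p hp
      have hp2 := (Finset.mem_Icc.1 (Finset.mem_product.1 (Finset.mem_filter.1 hp).1).2).2
      simp only [Finset.coe_range, Set.mem_Iio]
      have := Nat.log_mono_right (b := 2) hp2
      omega
  rw [Finset.sum_add_distrib]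
  refine le_trans ?_ (add_le_add (half z w) (half w z))
  have hswap : ((Finset.Icc 1 N ×ˢ Finset.Icc 1 N).filter
      (fun p : ℕ × ℕ => p.1 ≤ p.2 ∧ |(p.1 : ℝ) * w - p.2 * z| < 1)).card
      = (((Finset.Icc 1 N ×ˢ Finset.Icc 1 N).filter
      (fun p : ℕ × ℕ => p.1 ≤ p.2 ∧ |(p.1 : ℝ) * w - p.2 * z| < 1)).image Prod.swap).card :=
    (Finset.card_image_of_injective _ Prod.swap_injective).symm
  rw [hswap]
  refine le_trans (Finset.card_le_card fun p hp => ?_) (Finset.card_union_le _ _)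
  simp only [Finset.mem_union, Finset.mem_image, Finset.mem_filter, Finset.mem_product] at hp ⊢
  rcases le_total p.1 p.2 with h | h
  · exact Or.inl ⟨hp.1, h, hp.2⟩
  · exact Or.inr ⟨p.swap, ⟨⟨hp.1.2, hp.1.1⟩, h, by
      rw [abs_sub_comm]; exact hp.2⟩, p.swap_swap⟩

/-- The factors `a` and `c` are divisors of `r` and `s`, and they determine the cofactors `b` and
`d`. -/
lemma card_divisor_fiber_le {α : Type*} (S : Finset α) (a b c d : α → ℕ) (r s D : ℕ)
    (hr : r ≠ 0) (hs : s ≠ 0) (hrD : r.divisors.card ≤ D) (hsD : s.divisors.card ≤ D)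
    (hab : ∀ x ∈ S, a x * b x = r) (hcd : ∀ x ∈ S, c x * d x = s)
    (hinj : ∀ x ∈ S, ∀ y ∈ S, a x = a y → b x = b y → c x = c y → d x = d y → x = y) :
    S.card ≤ D ^ 2 := by
  rw [sq]
  refine le_trans ?_ (Nat.mul_le_mul hrD hsD)
  rw [← Finset.card_product]
  refine Finset.card_le_card_of_injOn (fun x => (a x, c x)) ?_ ?_
  · intro x hx
    simp only [Finset.coe_product, Set.mem_prod, Finset.mem_coe, Nat.mem_divisors]
    exact ⟨⟨Dvd.intro _ (hab x hx), hr⟩, ⟨Dvd.intro _ (hcd x hx), hs⟩⟩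
  · intro x hx y hy h
    simp only [Prod.mk.injEq] at h
    have h1 : b x = b y := by
      have e := (hab x hx).trans (hab y hy).symm
      rw [h.1] at e
      exact Nat.eq_of_mul_eq_mul_left (Nat.pos_of_ne_zero fun h0 => hr (by
        rw [← hab y hy, h0, zero_mul])) e
    have h2 : d x = d y := by
      have e := (hcd x hx).trans (hcd y hy).symm
      rw [h.2] at e
      exact Nat.eq_of_mul_eq_mul_left (Nat.pos_of_ne_zero fun h0 => hs (by
        rw [← hcd y hy, h0, zero_mul])) e
    exact hinj x hx y hy h.1 h1 h.2 h2

/-- Index set of the pairs `(k, l)` in a dyadic block. -/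
def blockPairs (L : ℕ) : Finset (ℕ × ℕ) :=
  (Finset.Icc 1 (2 * L) ×ˢ Finset.Icc 1 (2 * L)).filter
    (fun p : ℕ × ℕ => p.1 ≤ p.2 ∧ L ≤ p.2 ∧ p.2 < 2 * L)

lemma mem_blockPairs {L : ℕ} {p : ℕ × ℕ} (h : p ∈ blockPairs L) :
    1 ≤ p.1 ∧ p.1 ≤ p.2 ∧ L ≤ p.2 ∧ p.2 < 2 * L := by
  simp only [blockPairs, Finset.mem_filter, Finset.mem_product, Finset.mem_Icc] at h
  exact ⟨h.1.1.1, h.2⟩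

/-- Coincidences of the rescaled ratios `k z i / l` over a dyadic block. -/
lemma coincidences_block_le {ι : Type*} (I : Finset ι) (z : ι → ℝ) {L D : ℕ} (hL : 1 ≤ L)
    (hD : ∀ n, n ≠ 0 → n ≤ 4 * L ^ 2 → n.divisors.card ≤ D) :
    coincidences (blockPairs L ×ˢ I) (blockPairs L ×ˢ I)
        (fun p => ⌊(L : ℝ) * (p.1.1 * z p.2 / p.1.2)⌋)
        (fun p => ⌊(L : ℝ) * (p.1.1 * z p.2 / p.1.2)⌋)
      ≤ D ^ 2 * ∑ i ∈ I, ∑ j ∈ I, stripCount (4 * L ^ 2) (4 * L) (z i) (z j) := by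
  classical
  have hL0 : (1 : ℝ) ≤ L := by exact_mod_cast hL
  set T : Finset ((ι × ι) × (ℕ × ℕ)) :=
    ((I ×ˢ I) ×ˢ (Finset.Icc 1 (4 * L ^ 2) ×ˢ Finset.Icc 1 (4 * L ^ 2))).filter
      (fun t => |(t.2.1 : ℝ) * z t.1.1 - t.2.2 * z t.1.2| < 4 * L) with hT
  have hTcard : T.card = ∑ i ∈ I, ∑ j ∈ I, stripCount (4 * L ^ 2) (4 * L) (z i) (z j) := by
    rw [hT, Finset.card_filter, Finset.sum_product, Finset.sum_product]
    refine Finset.sum_congr rfl fun i _ => Finset.sum_congr rfl fun j _ => ?_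
    rw [stripCount, Finset.card_filter]
  rw [← hTcard]
  unfold coincidences
  -- Clearing denominators sends a coincidence to `(r, s) = (k l', k' l)`. Multiplying a difference
  -- below `1 / L` by `l l' < 4 L²` gives `|r z i - s z i'| < 4 L`, and each fibre is bounded by the
  -- numbers of divisors of `r` and `s`.
  refine Finset.card_le_mul_card_image_of_maps_to
    (f := fun q : ((ℕ × ℕ) × ι) × ((ℕ × ℕ) × ι) =>
      ((q.1.2, q.2.2), (q.1.1.1 * q.2.1.2, q.2.1.1 * q.1.1.2))) ?_ _ ?_
  · rintro ⟨⟨⟨k, l⟩, i⟩, ⟨⟨k', l'⟩, i'⟩⟩ hq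
    simp only [Finset.mem_filter, Finset.mem_product] at hq
    obtain ⟨⟨⟨hb, hi⟩, hb', hi'⟩, hfl⟩ := hq
    obtain ⟨h1, h2, h3, h4⟩ := mem_blockPairs hb
    obtain ⟨h1', h2', h3', h4'⟩ := mem_blockPairs hb'
    simp only at h1 h2 h3 h4 h1' h2' h3' h4'
    have hl0 : (0 : ℝ) < l := by exact_mod_cast (by omega : 0 < l)
    have hl0' : (0 : ℝ) < l' := by exact_mod_cast (by omega : 0 < l')
    simp only [hT, Finset.mem_filter, Finset.mem_product, Finset.mem_Icc]
    refine ⟨⟨⟨hi, hi'⟩, ⟨Nat.mul_pos h1 (by omega), ?_⟩, ⟨Nat.mul_pos h1' (by omega), ?_⟩⟩, ?_⟩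
    · calc k * l' ≤ (2 * L) * (2 * L) := Nat.mul_le_mul (by omega) (by omega)
        _ = 4 * L ^ 2 := by ring
    · calc k' * l ≤ (2 * L) * (2 * L) := Nat.mul_le_mul (by omega) (by omega)
        _ = 4 * L ^ 2 := by ring
    · have h := Int.abs_sub_lt_one_of_floor_eq_floor hfl
      have e : ((k * l' : ℕ) : ℝ) * z i - ((k' * l : ℕ) : ℝ) * z i'
          = (L * (k * z i / l) - L * (k' * z i' / l')) * (l * l' / L) := by
        push_cast; field_simp
      rw [e, abs_mul, abs_of_pos (by positivity : (0 : ℝ) < l * l' / L)]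
      have hl2 : (l : ℝ) ≤ 2 * L := by exact_mod_cast h4.le
      have hl2' : (l' : ℝ) ≤ 2 * L := by exact_mod_cast h4'.le
      calc _ < 1 * ((l : ℝ) * l' / L) := by gcongr
        _ ≤ 1 * ((2 * L) * (2 * L) / L) := by gcongr
        _ = 4 * L := by field_simp; ring
  · rintro ⟨⟨i, i'⟩, r, s⟩ ht
    simp only [hT, Finset.mem_filter, Finset.mem_product, Finset.mem_Icc] at ht
    obtain ⟨⟨-, ⟨hr1, hr2⟩, hs1, hs2⟩, -⟩ := ht
    refine card_divisor_fiber_le _ (fun q => q.1.1.1) (fun q => q.2.1.2) (fun q => q.2.1.1)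
      (fun q => q.1.1.2) r s D (by omega) (by omega) (hD r (by omega) hr2)
      (hD s (by omega) hs2) ?_ ?_ ?_
    · intro q hq
      have := (Finset.mem_filter.1 hq).2
      simp only [Prod.mk.injEq] at this
      exact this.2.1
    · intro q hq
      have := (Finset.mem_filter.1 hq).2
      simp only [Prod.mk.injEq] at this
      exact this.2.2
    · rintro ⟨⟨⟨k, l⟩, j⟩, ⟨⟨k', l'⟩, j'⟩⟩ hq ⟨⟨⟨k₂, l₂⟩, j₂⟩, ⟨⟨k₂', l₂'⟩, j₂'⟩⟩ hq₂ e1 e2 e3 e4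
      have h5 := (Finset.mem_filter.1 hq).2
      have h6 := (Finset.mem_filter.1 hq₂).2
      simp only [Prod.mk.injEq] at h5 h6 e1 e2 e3 e4 ⊢
      obtain ⟨⟨rfl, rfl⟩, -⟩ := h5
      obtain ⟨⟨rfl, rfl⟩, -⟩ := h6
      exact ⟨⟨⟨e1, e4⟩, rfl⟩, ⟨e3, e2⟩, rfl⟩

/-- Multiplying `|k z i - l z j| < 1` by `L / l ≤ 1` puts `L k z i / l` within distance 1 of `L z
j`, so the floors differ by at most 1 and `card_near_sq_le` applies. -/
lemma sum_blockCount_sq_le_coincidences {ι : Type*} (I : Finset ι) (z : ι → ℝ) {L : ℕ}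
    (hL : 1 ≤ L) :
    (∑ i ∈ I, ∑ j ∈ I, blockCount L (z i) (z j)) ^ 2
      ≤ 9 * (coincidences (blockPairs L ×ˢ I) (blockPairs L ×ˢ I)
        (fun p => ⌊(L : ℝ) * (p.1.1 * z p.2 / p.1.2)⌋)
        (fun p => ⌊(L : ℝ) * (p.1.1 * z p.2 / p.1.2)⌋)
        * coincidences I I (fun i => ⌊(L : ℝ) * z i⌋) (fun i => ⌊(L : ℝ) * z i⌋)) := by
  classical
  refine le_trans (Nat.pow_le_pow_left ?_ 2) (card_near_sq_le _ _ _ _)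
  have e : ∑ i ∈ I, ∑ j ∈ I, blockCount L (z i) (z j)
      = (((blockPairs L ×ˢ I) ×ˢ I).filter (fun p : ((ℕ × ℕ) × ι) × ι =>
        |(p.1.1.1 : ℝ) * z p.1.2 - p.1.1.2 * z p.2| < 1)).card := by
    symm
    rw [Finset.card_filter, Finset.sum_product, Finset.sum_product, Finset.sum_comm]
    refine Finset.sum_congr rfl fun i _ => ?_
    rw [Finset.sum_comm]
    refine Finset.sum_congr rfl fun j _ => ?_
    rw [blockCount, ← Finset.filter_filter, Finset.card_filter]
    rfl
  rw [e]
  refine Finset.card_le_card fun p hp => ?_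
  obtain ⟨⟨⟨k, l⟩, i⟩, j⟩ := p
  simp only [Finset.mem_filter, Finset.mem_product] at hp ⊢
  obtain ⟨⟨⟨hb, hi⟩, hj⟩, h⟩ := hp
  refine ⟨⟨⟨hb, hi⟩, hj⟩, ?_⟩
  obtain ⟨h1, h2, h3, h4⟩ := mem_blockPairs hb
  simp only at h1 h2 h3 h4
  have hl0 : (0 : ℝ) < l := by exact_mod_cast (by omega : 0 < l)
  have hLl : (L : ℝ) ≤ l := by exact_mod_cast h3
  have h5 : |(L : ℝ) * (k * z i / l) - L * z j| < 1 := by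
    have e : (L : ℝ) * (k * z i / l) - L * z j = (L / l) * (k * z i - l * z j) := by
      field_simp
    rw [e, abs_mul, abs_of_nonneg (by positivity)]
    have : (L : ℝ) / l ≤ 1 := by rw [div_le_one hl0]; exact hLl
    calc (L : ℝ) / l * |k * z i - l * z j| ≤ 1 * |k * z i - l * z j| := by gcongr
      _ < 1 := by rw [one_mul]; exact h
  have h6 := Int.floor_le ((L : ℝ) * (k * z i / l))
  have h7 := Int.lt_floor_add_one ((L : ℝ) * (k * z i / l))
  have h8 := Int.floor_le ((L : ℝ) * z j)
  have h9 := Int.lt_floor_add_one ((L : ℝ) * z j)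
  rw [abs_lt] at h5
  have h10 : ((⌊(L : ℝ) * (k * z i / l)⌋ : ℝ)) - ⌊(L : ℝ) * z j⌋ < 2 := by linarith
  have h11 : -2 < ((⌊(L : ℝ) * (k * z i / l)⌋ : ℝ)) - ⌊(L : ℝ) * z j⌋ := by linarith
  have h12 : ⌊(L : ℝ) * (k * z i / l)⌋ - ⌊(L : ℝ) * z j⌋ < 2 := by exact_mod_cast h10
  have h13 : -2 < ⌊(L : ℝ) * (k * z i / l)⌋ - ⌊(L : ℝ) * z j⌋ := by exact_mod_cast h11
  rw [abs_le]
  constructor <;> omega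

/-- Number of solutions of `|k z i - l z j| < 1` with `1 ≤ k, l ≤ N` and `i, j ∈ I`. -/
noncomputable def ratioCount {ι : Type*} (I : Finset ι) (z : ι → ℝ) (N : ℕ) : ℕ :=
  ∑ i ∈ I, ∑ j ∈ I, stripCount N 1 (z i) (z j)

/-- The two Cauchy–Schwarz factors carry `L ^ 3 G² + L (...)` and `N / L`. After cancellation only
`L² ≤ N²` remains, hence a bound uniform in the scale `L`. -/
lemma sum_blockCount_sq_le {ι : Type*} (I : Finset ι) (z : ι → ℝ) (hz : ∀ i ∈ I, 1 ≤ z i)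
    {L N D : ℕ} (hL : 1 ≤ L) (hLN : L ≤ N)
    (hD : ∀ n, n ≠ 0 → n ≤ 4 * N ^ 2 → n.divisors.card ≤ D) :
    ((∑ i ∈ I, ∑ j ∈ I, blockCount L (z i) (z j) : ℕ) : ℝ) ^ 2
      ≤ 27 * N * nearPairs I z (1 / N) * D ^ 2
        * (320 * N ^ 2 * (∑ i ∈ I, 1 / Real.sqrt (z i)) ^ 2
          + 40 * ((I.card : ℝ) ^ 2 + ratioCount I z N)) := by
  have hL0 : (1 : ℝ) ≤ L := by exact_mod_cast hL
  have hLp : (0 : ℝ) < L := by linarith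
  have hLN' : (L : ℝ) ≤ N := by exact_mod_cast hLN
  have hstrip : ((∑ i ∈ I, ∑ j ∈ I, stripCount (4 * L ^ 2) (4 * L) (z i) (z j) : ℕ) : ℝ)
      ≤ 320 * L ^ 3 * (∑ i ∈ I, 1 / Real.sqrt (z i)) ^ 2
        + 40 * L * ((I.card : ℝ) ^ 2 + ratioCount I z N) := by
    push_cast
    calc _ ≤ ∑ i ∈ I, ∑ j ∈ I, (320 * (L : ℝ) ^ 3 * (1 / Real.sqrt (z i)
          * (1 / Real.sqrt (z j))) + 40 * L * (stripCount N 1 (z i) (z j) + 1)) :=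
          Finset.sum_le_sum fun i hi => Finset.sum_le_sum fun j hj =>
            stripCount_le_sqrt hL hLN (hz i hi) (hz j hj)
      _ = _ := by
          simp only [Finset.sum_add_distrib, ← Finset.mul_sum, ratioCount, ← Finset.sum_mul]
          push_cast
          simp only [Finset.sum_const, nsmul_eq_mul, mul_one]
          ring
  have h1 := sum_blockCount_sq_le_coincidences I z hL
  have h2 := coincidences_block_le I z hL (fun n h0 hn => hD n h0 (hn.trans (by gcongr)))
  have h3 := coincidences_floor_le I z hL hLN
  set Q := ratioCount I z N
  set G := ∑ i ∈ I, 1 / Real.sqrt (z i)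
  set E := nearPairs I z (1 / N)
  calc ((∑ i ∈ I, ∑ j ∈ I, blockCount L (z i) (z j) : ℕ) : ℝ) ^ 2
      ≤ 9 * ((coincidences (blockPairs L ×ˢ I) (blockPairs L ×ˢ I)
        (fun p => ⌊(L : ℝ) * (p.1.1 * z p.2 / p.1.2)⌋)
        (fun p => ⌊(L : ℝ) * (p.1.1 * z p.2 / p.1.2)⌋) : ℝ)
        * coincidences I I (fun i => ⌊(L : ℝ) * z i⌋) (fun i => ⌊(L : ℝ) * z i⌋)) := by
          exact_mod_cast h1
    _ ≤ 9 * ((D ^ 2 * (320 * L ^ 3 * G ^ 2 + 40 * L * ((I.card : ℝ) ^ 2 + Q)))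
        * (3 * (N / L) * E)) := by
          gcongr
          calc _ ≤ ((D ^ 2 * ∑ i ∈ I, ∑ j ∈ I,
                stripCount (4 * L ^ 2) (4 * L) (z i) (z j) : ℕ) : ℝ) := by exact_mod_cast h2
            _ ≤ _ := by rw [Nat.cast_mul, Nat.cast_pow]; gcongr
    _ = 27 * N * E * D ^ 2 * (320 * L ^ 2 * G ^ 2 + 40 * ((I.card : ℝ) ^ 2 + Q)) := by
          field_simp; ring
    _ ≤ _ := by gcongr

/-- The energy inequality for the number of near-coincidences of dilated points. -/
theorem ratioCount_sq_le {ι : Type*} (I : Finset ι) (z : ι → ℝ) (hz : ∀ i ∈ I, 1 ≤ z i)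
    {N D : ℕ} (hN : 1 ≤ N) (hD : ∀ n, n ≠ 0 → n ≤ 4 * N ^ 2 → n.divisors.card ≤ D) :
    (ratioCount I z N : ℝ) ^ 2 ≤ 4 * (Nat.log 2 N + 1) ^ 2 *
      (27 * N * nearPairs I z (1 / N) * D ^ 2
        * (320 * N ^ 2 * (∑ i ∈ I, 1 / Real.sqrt (z i)) ^ 2
          + 40 * ((I.card : ℝ) ^ 2 + ratioCount I z N))) := by
  set X := 27 * (N : ℝ) * nearPairs I z (1 / N) * D ^ 2
        * (320 * N ^ 2 * (∑ i ∈ I, 1 / Real.sqrt (z i)) ^ 2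
          + 40 * ((I.card : ℝ) ^ 2 + ratioCount I z N)) with hX
  have hX0 : 0 ≤ X := by positivity
  have h1 : ratioCount I z N ≤ 2 * ∑ v ∈ Finset.range (Nat.log 2 N + 1),
      ∑ i ∈ I, ∑ j ∈ I, blockCount (2 ^ v) (z i) (z j) := by
    unfold ratioCount
    calc _ ≤ ∑ i ∈ I, ∑ j ∈ I, ∑ v ∈ Finset.range (Nat.log 2 N + 1),
          (blockCount (2 ^ v) (z i) (z j) + blockCount (2 ^ v) (z j) (z i)) :=
          Finset.sum_le_sum fun i _ => Finset.sum_le_sum fun j _ =>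
            stripCount_le_sum_blockCount N (z i) (z j)
      _ = ∑ v ∈ Finset.range (Nat.log 2 N + 1), ∑ i ∈ I, ∑ j ∈ I,
          (blockCount (2 ^ v) (z i) (z j) + blockCount (2 ^ v) (z j) (z i)) := by
          exact (Finset.sum_congr rfl fun i _ => Finset.sum_comm).trans Finset.sum_comm
      _ = _ := by
          rw [Finset.mul_sum]
          refine Finset.sum_congr rfl fun v _ => ?_
          simp only [Finset.sum_add_distrib]
          rw [Finset.sum_comm (f := fun i j => blockCount (2 ^ v) (z j) (z i)), two_mul]
  -- Each dyadic scale contributes at most `√X`, and there are `Nat.log 2 N + 1` scales.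
  have h2 : (ratioCount I z N : ℝ) ≤ 2 * ((Nat.log 2 N + 1) * Real.sqrt X) := by
    calc (ratioCount I z N : ℝ) ≤ ((2 * ∑ v ∈ Finset.range (Nat.log 2 N + 1),
          ∑ i ∈ I, ∑ j ∈ I, blockCount (2 ^ v) (z i) (z j) : ℕ) : ℝ) := by exact_mod_cast h1
      _ = 2 * ∑ v ∈ Finset.range (Nat.log 2 N + 1),
          ((∑ i ∈ I, ∑ j ∈ I, blockCount (2 ^ v) (z i) (z j) : ℕ) : ℝ) := by push_cast; rfl
      _ ≤ 2 * ∑ v ∈ Finset.range (Nat.log 2 N + 1), Real.sqrt X := by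
          gcongr with v hv
          refine Real.le_sqrt_of_sq_le ?_
          refine sum_blockCount_sq_le I z hz Nat.one_le_two_pow ?_ hD
          exact Nat.pow_le_of_le_log (by omega) (by have := Finset.mem_range.1 hv; omega)
      _ = _ := by simp
  calc (ratioCount I z N : ℝ) ^ 2 ≤ (2 * ((Nat.log 2 N + 1) * Real.sqrt X)) ^ 2 := by gcongr
    _ = 4 * (Nat.log 2 N + 1) ^ 2 * Real.sqrt X ^ 2 := by ring
    _ = _ := by rw [Real.sq_sqrt hX0]

/-! ### The divisor bound -/

/-- The divisor bound. -/
theorem exists_card_divisors_le_rpow {ε : ℝ} (hε : 0 < ε) :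
    ∃ C : ℝ, 0 < C ∧ ∀ n : ℕ, n ≠ 0 → (n.divisors.card : ℝ) ≤ C * (n : ℝ) ^ ε := by
  classical
  set e : ℝ := min 1 (ε * Real.log 2) with he
  have hlog2 : 0 < Real.log 2 := Real.log_pos one_lt_two
  have he0 : 0 < e := lt_min one_pos (by positivity)
  have he1 : e ≤ 1 := min_le_left _ _
  have hM1 : 1 ≤ e⁻¹ := (one_le_inv₀ he0).2 he1
  set P : ℕ := ⌈(2 : ℝ) ^ (1 / ε)⌉₊ with hP
  refine ⟨e⁻¹ ^ P, by positivity, fun n hn => ?_⟩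
  -- For `p ≥ 2 ^ (1 / ε)` one has `p ^ ε ≥ 2`, and `a + 1 ≤ 2 ^ a` costs no constant. Each of the
  -- fewer than `P` smaller primes costs a factor `e⁻¹`, by `1 + y ≤ exp y` with `y = a ε log 2`.
  have hterm : ∀ p ∈ n.primeFactors, ((n.factorization p + 1 : ℕ) : ℝ)
      ≤ (if p < P then e⁻¹ else 1) * ((p : ℝ) ^ n.factorization p) ^ ε := by
    intro p hp
    have hp2 : 2 ≤ p := (Nat.prime_of_mem_primeFactors hp).two_le
    have hp2' : (2 : ℝ) ≤ p := by exact_mod_cast hp2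
    generalize n.factorization p = a
    have hswap : ((p : ℝ) ^ a) ^ ε = ((p : ℝ) ^ ε) ^ a := by
      rw [← Real.rpow_natCast, ← Real.rpow_natCast, ← Real.rpow_mul (by positivity),
        ← Real.rpow_mul (by positivity), mul_comm]
    split_ifs with h
    · rw [← div_eq_inv_mul, le_div_iff₀ he0, hswap]
      calc ((a + 1 : ℕ) : ℝ) * e ≤ a * (ε * Real.log 2) + 1 := by
            push_cast
            have := min_le_right 1 (ε * Real.log 2)
            have h3 : (a : ℝ) * e ≤ a * (ε * Real.log 2) := by gcongr
            linarith
        _ ≤ Real.exp (a * (ε * Real.log 2)) := Real.add_one_le_exp _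
        _ = ((2 : ℝ) ^ ε) ^ a := by
            rw [Real.rpow_def_of_pos two_pos, ← Real.exp_nat_mul]; ring_nf
        _ ≤ ((p : ℝ) ^ ε) ^ a := by gcongr
    · rw [one_mul, hswap]
      have h2 : (2 : ℝ) ≤ (p : ℝ) ^ ε := by
        have h3 : (2 : ℝ) ^ (1 / ε) ≤ p :=
          (Nat.le_ceil _).trans (by exact_mod_cast not_lt.1 h)
        calc (2 : ℝ) = ((2 : ℝ) ^ (1 / ε)) ^ ε := by
              rw [← Real.rpow_mul two_pos.le, one_div_mul_cancel hε.ne', Real.rpow_one]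
          _ ≤ _ := by gcongr
      calc ((a + 1 : ℕ) : ℝ) ≤ 2 ^ a := by exact_mod_cast (Nat.lt_two_pow_self (n := a))
        _ ≤ _ := by gcongr
  have hprod : ∏ p ∈ n.primeFactors, ((p : ℝ) ^ n.factorization p) ^ ε = (n : ℝ) ^ ε := by
    rw [Real.finsetProd_rpow _ _ (fun p _ => by positivity)]
    congr 1
    conv_rhs => rw [← Nat.prod_factorization_pow_eq_self hn]
    rw [Finsupp.prod, Nat.support_factorization]
    push_cast
    rfl
  have hc : ∏ p ∈ n.primeFactors, (if p < P then e⁻¹ else (1 : ℝ)) ≤ e⁻¹ ^ P := by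
    rw [Finset.prod_ite, Finset.prod_const, Finset.prod_const_one, mul_one]
    refine pow_le_pow_right₀ hM1 ?_
    calc _ ≤ (Finset.range P).card := Finset.card_le_card fun p hp => by
          simpa using (Finset.mem_filter.1 hp).2
      _ = P := Finset.card_range P
  rw [Nat.card_divisors hn, Nat.cast_prod]
  calc _ ≤ ∏ p ∈ n.primeFactors,
        (if p < P then e⁻¹ else 1) * ((p : ℝ) ^ n.factorization p) ^ ε :=
        Finset.prod_le_prod (fun p _ => by positivity) hterm
    _ = (∏ p ∈ n.primeFactors, (if p < P then e⁻¹ else (1 : ℝ))) * (n : ℝ) ^ ε := by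
        rw [Finset.prod_mul_distrib, hprod]
    _ ≤ _ := by gcongr

/-! ### Gaps of the sequence and the contribution of small gaps -/

/-- The pairs `1 ≤ n₁ < n₂ ≤ N`. -/
def ltPairs (N : ℕ) : Finset (ℕ × ℕ) :=
  (Finset.Icc 1 N ×ˢ Finset.Icc 1 N).filter (fun p => p.1 < p.2)

lemma mem_ltPairs {N : ℕ} {p : ℕ × ℕ} : p ∈ ltPairs N ↔ 1 ≤ p.1 ∧ p.1 < p.2 ∧ p.2 ≤ N := by
  simp only [ltPairs, Finset.mem_filter, Finset.mem_product, Finset.mem_Icc]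
  constructor
  · rintro ⟨⟨⟨h1, h2⟩, h3, h4⟩, h5⟩; exact ⟨h1, h5, h4⟩
  · rintro ⟨h1, h2, h3⟩; exact ⟨⟨⟨h1, by omega⟩, by omega, h3⟩, h2⟩

/-- The gap of a sequence along a pair of indices. -/
def gap (x : ℕ → ℝ) (p : ℕ × ℕ) : ℝ := x p.2 - x p.1

lemma nearPairs_gap_le_approxEnergy (x : ℕ → ℝ) (N : ℕ) (γ : ℝ) (I : Finset (ℕ × ℕ))
    (hI : I ⊆ ltPairs N) : nearPairs I (gap x) γ ≤ approxEnergy x N γ := by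
  classical
  unfold nearPairs approxEnergy
  refine Finset.card_le_card_of_injOn (fun q => (q.1.2, q.1.1, q.2.1, q.2.2)) ?_ ?_
  · rintro ⟨⟨a, b⟩, a', b'⟩ hq
    simp only [Finset.coe_filter, Finset.mem_product, Set.mem_ofPred_eq] at hq
    obtain ⟨⟨h1, h2⟩, h3⟩ := hq
    have h1' := mem_ltPairs.1 (hI h1)
    have h2' := mem_ltPairs.1 (hI h2)
    simp only at h1' h2'
    simp only [Finset.coe_filter, Finset.mem_product, Finset.mem_Icc, Set.mem_ofPred_eq]
    refine ⟨⟨⟨by omega, by omega⟩, ⟨by omega, by omega⟩, ⟨by omega, by omega⟩, by omega,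
      by omega⟩, ?_⟩
    simp only [gap] at h3
    rwa [show x b - x a + x a' - x b' = x b - x a - (x b' - x a') by ring]
  · rintro ⟨⟨a, b⟩, a', b'⟩ _ ⟨⟨a₂, b₂⟩, a₂', b₂'⟩ _ h
    simp only [Prod.mk.injEq] at h ⊢
    tauto

lemma card_ltPairs_le (N : ℕ) : (ltPairs N).card ≤ N ^ 2 := by
  refine (Finset.card_filter_le _ _).trans ?_
  simp [sq]

/-- Telescoping: each step up to index `N` is at least `c / N ^ (1 - η)`. -/
lemma le_gap {x : ℕ → ℝ} {c η : ℝ} (hc : 0 < c) (hη1 : η ≤ 1)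
    (hspacing : ∀ n : ℕ, 1 ≤ n → c / (n : ℝ) ^ (1 - η) ≤ x (n + 1) - x n) {N : ℕ}
    {p : ℕ × ℕ} (hp : p ∈ ltPairs N) :
    c / (N : ℝ) ^ (1 - η) * ((p.2 - p.1 : ℕ) : ℝ) ≤ gap x p := by
  obtain ⟨m, n⟩ := p
  obtain ⟨h1, h2, h3⟩ := mem_ltPairs.1 hp
  simp only at h1 h2 h3
  have key : ∀ d : ℕ, m + d ≤ N → c / (N : ℝ) ^ (1 - η) * d ≤ x (m + d) - x m := by
    intro d
    induction d with
    | zero => intro _; simp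
    | succ d ih =>
      intro hd
      have h4 := ih (by omega)
      have h5 := hspacing (m + d) (by omega)
      have hmd : (0 : ℝ) < ((m + d : ℕ) : ℝ) := by exact_mod_cast (by omega : 0 < m + d)
      have h6 : c / (N : ℝ) ^ (1 - η) ≤ c / ((m + d : ℕ) : ℝ) ^ (1 - η) := by
        gcongr
        · linarith
      rw [← add_assoc]
      push_cast at *
      linarith
  have := key (n - m) (by omega)
  rw [show m + (n - m) = n by omega] at this
  exact this

/-- By `le_gap` the sum over each first index is dominated by a harmonic sum in the difference of
the indices. -/
lemma sum_inv_gap_le {x : ℕ → ℝ} {c η : ℝ} (hc : 0 < c) (hη1 : η ≤ 1)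
    (hspacing : ∀ n : ℕ, 1 ≤ n → c / (n : ℝ) ^ (1 - η) ≤ x (n + 1) - x n) {N : ℕ}
    (hN : 1 ≤ N) :
    ∑ p ∈ ltPairs N, (gap x p)⁻¹ ≤ (N : ℝ) ^ (1 - η) / c * (N * (1 + Real.log N)) := by
  have hN0 : (0 : ℝ) < N := by exact_mod_cast hN
  have hNp : 0 < (N : ℝ) ^ (1 - η) := Real.rpow_pos_of_pos hN0 _
  calc ∑ p ∈ ltPairs N, (gap x p)⁻¹
      ≤ ∑ p ∈ ltPairs N, (N : ℝ) ^ (1 - η) / c * (((p.2 - p.1 : ℕ) : ℝ))⁻¹ := by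
        refine Finset.sum_le_sum fun p hp => ?_
        have h2 := (mem_ltPairs.1 hp).2.1
        have h3 : (0 : ℝ) < ((p.2 - p.1 : ℕ) : ℝ) := by exact_mod_cast (by omega : 0 < p.2 - p.1)
        rw [← inv_div, ← mul_inv]
        exact inv_anti₀ (by positivity) (le_gap hc hη1 hspacing hp)
    _ = (N : ℝ) ^ (1 - η) / c * ∑ p ∈ ltPairs N, (((p.2 - p.1 : ℕ) : ℝ))⁻¹ := by
        rw [Finset.mul_sum]
    _ ≤ (N : ℝ) ^ (1 - η) / c * ∑ q ∈ Finset.Icc 1 N ×ˢ Finset.Icc 1 N, ((q.2 : ℕ) : ℝ)⁻¹ := by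
        refine mul_le_mul_of_nonneg_left ?_ (by positivity)
        rw [← Finset.sum_image (f := fun q : ℕ × ℕ => ((q.2 : ℕ) : ℝ)⁻¹)
          (g := fun p : ℕ × ℕ => (p.1, p.2 - p.1)) (s := ltPairs N)]
        · refine Finset.sum_le_sum_of_subset_of_nonneg ?_ (fun _ _ _ => by positivity)
          intro q hq
          obtain ⟨p, hp, rfl⟩ := Finset.mem_image.1 hq
          have := mem_ltPairs.1 hp
          simp only [Finset.mem_product, Finset.mem_Icc]
          omega
        · intro p hp q hq h
          have h1 := mem_ltPairs.1 hp
          have h2 := mem_ltPairs.1 hq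
          simp only [Prod.mk.injEq] at h
          exact Prod.ext h.1 (by omega)
    _ ≤ _ := by
        refine mul_le_mul_of_nonneg_left ?_ (by positivity)
        rw [Finset.sum_product]
        have h := harmonic_le_one_add_log N
        rw [harmonic_eq_sum_Icc] at h
        push_cast at h
        simp only [Finset.sum_const, Nat.card_Icc, Nat.add_sub_cancel, nsmul_eq_mul]
        gcongr

lemma card_nat_lt_le {T : ℝ} (hT : 0 ≤ T) (F : Finset ℕ)
    (hF : ∀ k ∈ F, 1 ≤ k ∧ (k : ℝ) ≤ T) : (F.card : ℝ) ≤ T := by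
  calc (F.card : ℝ) ≤ (Finset.Icc 1 ⌊T⌋₊).card := by
        exact_mod_cast Finset.card_le_card fun k hk =>
          Finset.mem_Icc.2 ⟨(hF k hk).1, Nat.le_floor (hF k hk).2⟩
    _ = ⌊T⌋₊ := by simp
    _ ≤ T := Nat.floor_le hT

lemma card_nat_near_le {T y : ℝ} (hT : 1 ≤ T) (F : Finset ℕ)
    (hF : ∀ k ∈ F, |y - k| < T) : (F.card : ℝ) ≤ 3 * T := by
  have h1 : (F.card : ℝ) = (F.image (fun k : ℕ => (k : ℤ))).card := by
    rw [Finset.card_image_of_injective _ Nat.cast_injective]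
  rw [h1]
  have h2 : F.image (fun k : ℕ => (k : ℤ)) ⊆ Finset.Icc ⌈y - T⌉ ⌊y + T⌋ := by
    intro d hd
    obtain ⟨k, hk, rfl⟩ := Finset.mem_image.1 hd
    have := abs_lt.1 (hF k hk)
    rw [Finset.mem_Icc]
    exact ⟨Int.ceil_le.2 (by push_cast; linarith), Int.le_floor.2 (by push_cast; linarith)⟩
  calc _ ≤ ((Finset.Icc ⌈y - T⌉ ⌊y + T⌋).card : ℝ) := by exact_mod_cast Finset.card_le_card h2
    _ = (((⌊y + T⌋ + 1 - ⌈y - T⌉).toNat : ℤ) : ℝ) := by rw [Int.card_Icc, Int.cast_natCast]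
    _ ≤ 3 * T := by
        rw [Int.toNat_eq_max]
        push_cast
        refine max_le ?_ (by linarith)
        have := Int.floor_le (y + T)
        have := Int.le_ceil (y - T)
        linarith

/-- For fixed `k` the admissible `l` lie in an interval of length `2 / w`, where `1 / w > 1`; and `k
z < l w + 1 ≤ N + 1` limits `k`. -/
lemma stripCount_le_of_lt_one {N : ℕ} {z w : ℝ} (hz : 0 < z) (hw : 0 < w) (hw1 : w < 1) :
    (stripCount N 1 z w : ℝ) ≤ 3 * (N + 1) * (z⁻¹ * w⁻¹) := by
  classical
  unfold stripCount
  set S := ((Finset.Icc 1 N ×ˢ Finset.Icc 1 N).filter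
    (fun p : ℕ × ℕ => |(p.1 : ℝ) * z - p.2 * w| < 1)) with hS
  have hmem : ∀ p ∈ S, 1 ≤ p.1 ∧ p.2 ≤ N ∧ |(p.1 : ℝ) * z - p.2 * w| < 1 := by
    intro p hp
    simp only [hS, Finset.mem_filter, Finset.mem_product, Finset.mem_Icc] at hp
    exact ⟨hp.1.1.1, hp.1.2.2, hp.2⟩
  have hw1' : 1 ≤ w⁻¹ := (one_le_inv₀ hw).2 hw1.le
  have hfib : ∀ k ∈ S.image Prod.fst, ((S.filter (fun p => p.1 = k)).card : ℝ) ≤ 3 * w⁻¹ := by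
    intro k _
    rw [← Finset.card_image_of_injOn (s := S.filter (fun p => p.1 = k)) (f := Prod.snd)]
    · refine card_nat_near_le (y := k * z / w) hw1' _ ?_
      intro l hl
      obtain ⟨p, hp, rfl⟩ := Finset.mem_image.1 hl
      rw [Finset.mem_filter] at hp
      have h := (hmem p hp.1).2.2
      rw [hp.2] at h
      have e : (k : ℝ) * z / w - p.2 = (k * z - p.2 * w) * w⁻¹ := by field_simp
      rw [e, abs_mul, abs_of_pos (inv_pos.2 hw)]
      exact mul_lt_of_lt_one_left (inv_pos.2 hw) h
    · intro p hp q hq h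
      have h1 := (Finset.mem_filter.1 hp).2
      have h2 := (Finset.mem_filter.1 hq).2
      exact Prod.ext (h1.trans h2.symm) h
  have himg : ((S.image Prod.fst).card : ℝ) ≤ (N + 1) * z⁻¹ := by
    refine card_nat_lt_le (by positivity) _ ?_
    intro k hk
    obtain ⟨p, hp, rfl⟩ := Finset.mem_image.1 hk
    obtain ⟨h1, h2, h3⟩ := hmem p hp
    refine ⟨h1, ?_⟩
    rw [← div_eq_mul_inv, le_div_iff₀ hz]
    have h4 : (p.2 : ℝ) ≤ N := by exact_mod_cast h2
    have h5 := (abs_lt.1 h3).2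
    have h6 : (p.2 : ℝ) * w ≤ N * 1 := by gcongr
    linarith
  rw [Finset.card_eq_sum_card_image Prod.fst S]
  push_cast
  calc _ ≤ ∑ k ∈ S.image Prod.fst, 3 * w⁻¹ := Finset.sum_le_sum hfib
    _ = (S.image Prod.fst).card * (3 * w⁻¹) := by simp
    _ ≤ (N + 1) * z⁻¹ * (3 * w⁻¹) := by gcongr
    _ = _ := by ring

/-- Splitting off the pairs with gap less than one. -/
lemma ratioCount_gap_le {x : ℕ → ℝ} {N : ℕ} (hpos : ∀ p ∈ ltPairs N, 0 < gap x p) :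
    (ratioCount (ltPairs N) (gap x) N : ℝ)
      ≤ ratioCount ((ltPairs N).filter (fun p => 1 ≤ gap x p)) (gap x) N
        + 3 * (N + 1) * (∑ p ∈ ltPairs N, (gap x p)⁻¹) ^ 2 := by
  have h1 : ratioCount ((ltPairs N).filter (fun p => 1 ≤ gap x p)) (gap x) N
      = ∑ p ∈ ltPairs N, ∑ q ∈ ltPairs N,
        if 1 ≤ gap x p ∧ 1 ≤ gap x q then stripCount N 1 (gap x p) (gap x q) else 0 := by
    unfold ratioCount
    rw [Finset.sum_filter]
    refine Finset.sum_congr rfl fun p _ => ?_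
    split_ifs with h
    · rw [Finset.sum_filter]; simp [h]
    · simp [h]
  rw [h1, ratioCount]
  push_cast
  rw [sq, Finset.sum_mul_sum, Finset.mul_sum, ← Finset.sum_add_distrib]
  refine Finset.sum_le_sum fun p hp => ?_
  rw [Finset.mul_sum, ← Finset.sum_add_distrib]
  refine Finset.sum_le_sum fun q hq => ?_
  have hp0 := hpos p hp
  have hq0 := hpos q hq
  split_ifs with h
  · exact le_add_of_nonneg_right (by positivity)
  · rw [zero_add]
    rw [not_and_or, not_le, not_le] at h
    rcases h with h | h
    · rw [stripCount_comm, mul_comm (gap x p)⁻¹]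
      exact stripCount_le_of_lt_one hq0 hp0 h
    · exact stripCount_le_of_lt_one hp0 hq0 h

/-! ### Power saving for the ratio count -/

/-- Resolves the energy inequality, in which the unknown count occurs on both sides. -/
lemma le_of_sq_le_mul_add {q a b : ℝ} (ha : 0 ≤ a) (h : q ^ 2 ≤ a * (b + q)) : q ≤ a + Real.sqrt (a * b) := by
  by_contra! hlt
  have hs := Real.sqrt_nonneg (a * b)
  have h1 : a * b < (q - a) ^ 2 :=
    (Real.sqrt_lt' (by linarith)).1 (by linarith)
  nlinarith

lemma one_add_log_le_rpow {N s : ℝ} (hN : 1 ≤ N) (hs : 0 < s) :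
    1 + Real.log N ≤ (1 + 1 / s) * N ^ s := by
  have h1 := Real.log_le_rpow_div (by linarith : 0 ≤ N) hs
  have h2 : 1 ≤ N ^ s := Real.one_le_rpow hN hs.le
  calc 1 + Real.log N ≤ N ^ s + N ^ s / s := add_le_add h2 h1
    _ = _ := by ring

lemma natLog_add_one_le_rpow {N : ℕ} {s : ℝ} (hN : 1 ≤ N) (hs : 0 < s) :
    (Nat.log 2 N : ℝ) + 1 ≤ (1 + 1 / s / Real.log 2) * (N : ℝ) ^ s := by
  have hN' : (1 : ℝ) ≤ N := by exact_mod_cast hN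
  have hlog2 : 0 < Real.log 2 := Real.log_pos one_lt_two
  have h1 := Real.log_le_rpow_div (by linarith : (0 : ℝ) ≤ N) hs
  have h2 : 1 ≤ (N : ℝ) ^ s := Real.one_le_rpow hN' hs.le
  have h3 : (Nat.log 2 N : ℝ) ≤ Real.log N / Real.log 2 := by
    rw [le_div_iff₀ hlog2, ← Real.log_pow]
    refine Real.log_le_log (by positivity) ?_
    exact_mod_cast Nat.pow_log_le_self 2 (by omega)
  calc (Nat.log 2 N : ℝ) + 1 ≤ (N : ℝ) ^ s / s / Real.log 2 + (N : ℝ) ^ s := by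
        refine add_le_add (h3.trans ?_) h2
        gcongr
    _ = _ := by ring

lemma energy_bound_mono {l e d g i q n l' e' d' g' : ℝ} (hl : 0 ≤ l) (he : 0 ≤ e) (hd : 0 ≤ d)
    (hg : 0 ≤ g) (hi : 0 ≤ i) (hq : 0 ≤ q) (hn : 0 ≤ n) (hll : l ≤ l') (hee : e ≤ e')
    (hdd : d ≤ d') (hgg : g ≤ g') (hii : i ≤ n ^ 2) :
    4 * l ^ 2 * (27 * n * e * d ^ 2 * (320 * n ^ 2 * g ^ 2 + 40 * (i ^ 2 + q)))
      ≤ 4 * l' ^ 2 * (27 * n * e' * d' ^ 2 * (320 * (n ^ 2 * g' ^ 2) + 40 * (n ^ 4 + q))) := by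
  have h : 320 * n ^ 2 * g ^ 2 + 40 * (i ^ 2 + q)
      ≤ 320 * (n ^ 2 * g' ^ 2) + 40 * (n ^ 4 + q) := by
    have h1 : i ^ 2 ≤ n ^ 4 := by
      calc i ^ 2 ≤ (n ^ 2) ^ 2 := by gcongr
        _ = n ^ 4 := by ring
    have h2 : n ^ 2 * g ^ 2 ≤ n ^ 2 * g' ^ 2 := by gcongr
    linarith
  have he' := he.trans hee
  gcongr

/-- Power saving in the count for gaps at least one. -/
lemma exists_ratioCount_filter_le {x : ℕ → ℝ} {δ κ : ℝ} (hδ : 0 < δ) (hκ : 0 ≤ κ)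
    (henergy : (fun N : ℕ => (approxEnergy x N (1 / (N : ℝ)) : ℝ))
      =O[atTop] (fun N : ℕ => (N : ℝ) ^ (3 - κ - δ)))
    (hgrowth : (fun N : ℕ => gapSum x N)
      =O[atTop] (fun N : ℕ => (N : ℝ) ^ (1 + κ / 2))) :
    ∃ C : ℝ, 0 < C ∧ ∀ᶠ N : ℕ in atTop,
      (ratioCount ((ltPairs N).filter (fun p => 1 ≤ gap x p)) (gap x) N : ℝ)
        ≤ C * (N : ℝ) ^ (4 - 3 * δ / 8) := by
  obtain ⟨CE, hCE, hE⟩ := henergy.exists_pos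
  obtain ⟨CG, hCG, hG⟩ := hgrowth.exists_pos
  -- Divisors are taken of integers up to `4 N²`, so the exponent `δ / 32` costs `N ^ (δ / 16)`. The
  -- logarithm is allowed the same loss; both enter squared, for a total of `δ / 4` out of the
  -- saving `δ`.
  obtain ⟨CD, hCD, hD⟩ := exists_card_divisors_le_rpow (ε := δ / 32) (by positivity)
  have hlog2 : 0 < Real.log 2 := Real.log_pos one_lt_two
  set CL : ℝ := 1 + 1 / (δ / 16) / Real.log 2 with hCL
  have hCL0 : 0 < CL := by positivity
  set C : ℝ := 4 * CL ^ 2 * 27 * CE * (CD * 4 ^ (δ / 32)) ^ 2 * (320 * CG ^ 2 + 40) with hC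
  have hC0 : 0 < C := by positivity
  refine ⟨C + Real.sqrt C, by positivity, ?_⟩
  filter_upwards [hE.bound, hG.bound, eventually_ge_atTop 1] with N hEN hGN hN
  have hN1 : (1 : ℝ) ≤ N := by exact_mod_cast hN
  have hN0 : (0 : ℝ) < N := by linarith
  set I := (ltPairs N).filter (fun p => 1 ≤ gap x p) with hI
  set Q : ℝ := (ratioCount I (gap x) N : ℝ) with hQ
  have hQ0 : 0 ≤ Q := Nat.cast_nonneg _
  set D : ℕ := ⌊CD * 4 ^ (δ / 32) * (N : ℝ) ^ (δ / 16)⌋₊ with hDdef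
  have hDle : (D : ℝ) ≤ CD * 4 ^ (δ / 32) * (N : ℝ) ^ (δ / 16) := Nat.floor_le (by positivity)
  have hDiv : ∀ n, n ≠ 0 → n ≤ 4 * N ^ 2 → n.divisors.card ≤ D := by
    intro n hn0 hn
    refine Nat.le_floor ((hD n hn0).trans ?_)
    have h1 : (n : ℝ) ≤ 4 * (N : ℝ) ^ 2 := by exact_mod_cast hn
    calc CD * (n : ℝ) ^ (δ / 32) ≤ CD * (4 * (N : ℝ) ^ 2) ^ (δ / 32) := by gcongr
      _ = _ := by
        rw [Real.mul_rpow (by norm_num) (by positivity), ← Real.rpow_natCast (N : ℝ) 2,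
          ← Real.rpow_mul hN0.le, mul_assoc]
        congr 3
        push_cast; ring
  have hmain := ratioCount_sq_le I (gap x) (fun i hi => (Finset.mem_filter.1 hi).2) hN hDiv
  have hEb : (nearPairs I (gap x) (1 / N) : ℝ) ≤ CE * (N : ℝ) ^ (3 - κ - δ) := by
    rw [Real.norm_of_nonneg (Nat.cast_nonneg _), Real.norm_of_nonneg (by positivity)] at hEN
    refine le_trans ?_ hEN
    exact_mod_cast nearPairs_gap_le_approxEnergy x N _ I (Finset.filter_subset _ _)
  have hGsum : ∑ i ∈ I, 1 / Real.sqrt (gap x i) = gapSum x N := by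
    unfold gapSum
    refine Finset.sum_congr ?_ fun _ _ => rfl
    rw [hI, ltPairs, Finset.filter_filter]
    rfl
  have hGb : ∑ i ∈ I, 1 / Real.sqrt (gap x i) ≤ CG * (N : ℝ) ^ (1 + κ / 2) := by
    rw [hGsum]
    rw [Real.norm_of_nonneg (by positivity : 0 ≤ (N : ℝ) ^ (1 + κ / 2))] at hGN
    exact (le_abs_self _).trans hGN
  have hG0 : 0 ≤ ∑ i ∈ I, 1 / Real.sqrt (gap x i) := Finset.sum_nonneg fun _ _ => by positivity
  have hIcard : (I.card : ℝ) ≤ (N : ℝ) ^ 2 := by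
    exact_mod_cast (Finset.card_filter_le _ _).trans (card_ltPairs_le N)
  have hLog : (Nat.log 2 N : ℝ) + 1 ≤ CL * (N : ℝ) ^ (δ / 16) :=
    natLog_add_one_le_rpow hN (by positivity : 0 < δ / 16)
  rw [← hQ] at hmain
  have hpow4 : (N : ℝ) ^ 4 ≤ (N : ℝ) ^ (4 + κ) := by
    rw [← Real.rpow_natCast]
    exact Real.rpow_le_rpow_of_exponent_le hN1 (by push_cast; linarith)
  have e1 : ((N : ℝ) ^ (δ / 16)) ^ 2 = (N : ℝ) ^ (δ / 8) := by
    rw [← Real.rpow_natCast, ← Real.rpow_mul hN0.le]; congr 1; push_cast; ring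
  have e2 : (N : ℝ) ^ 2 * ((N : ℝ) ^ (1 + κ / 2)) ^ 2 = (N : ℝ) ^ (4 + κ) := by
    rw [← Real.rpow_natCast, ← Real.rpow_natCast, ← Real.rpow_mul hN0.le,
      ← Real.rpow_add hN0]
    congr 1; push_cast; ring
  have e3 : (N : ℝ) ^ (δ / 8) * N * (N : ℝ) ^ (3 - κ - δ) * (N : ℝ) ^ (δ / 8)
      = (N : ℝ) ^ (4 - κ - 3 * δ / 4) := by
    nth_rewrite 2 [← Real.rpow_one (N : ℝ)]
    rw [← Real.rpow_add hN0, ← Real.rpow_add hN0, ← Real.rpow_add hN0]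
    congr 1; ring
  set A : ℝ := (N : ℝ) ^ (4 - κ - 3 * δ / 4) with hA
  set B : ℝ := (N : ℝ) ^ (4 + κ) with hB
  have hA0 : 0 ≤ A := by positivity
  have hB0 : 0 ≤ B := by positivity
  have hsq : Q ^ 2 ≤ C * A * (B + Q) := by
    calc Q ^ 2 ≤ _ := hmain
      _ ≤ _ := energy_bound_mono (by positivity) (Nat.cast_nonneg _) (Nat.cast_nonneg _) hG0
          (Nat.cast_nonneg _) hQ0 hN0.le hLog hEb hDle hGb hIcard
      _ = 4 * CL ^ 2 * 27 * CE * (CD * 4 ^ (δ / 32)) ^ 2 *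
          (((N : ℝ) ^ (δ / 16)) ^ 2 * N * (N : ℝ) ^ (3 - κ - δ) * ((N : ℝ) ^ (δ / 16)) ^ 2) *
          (320 * CG ^ 2 * (N ^ 2 * ((N : ℝ) ^ (1 + κ / 2)) ^ 2) + 40 * ((N : ℝ) ^ 4 + Q)) := by
          generalize (N : ℝ) ^ (δ / 16) = u
          generalize (N : ℝ) ^ (3 - κ - δ) = v
          generalize (N : ℝ) ^ (1 + κ / 2) = w
          generalize (4 : ℝ) ^ (δ / 32) = f
          clear_value Q CL
          ring
      _ = 4 * CL ^ 2 * 27 * CE * (CD * 4 ^ (δ / 32)) ^ 2 * A *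
          (320 * CG ^ 2 * B + 40 * ((N : ℝ) ^ 4 + Q)) := by
          rw [e1, e2, e3]
      _ ≤ 4 * CL ^ 2 * 27 * CE * (CD * 4 ^ (δ / 32)) ^ 2 * A *
          ((320 * CG ^ 2 + 40) * (B + Q)) := by
          refine mul_le_mul_of_nonneg_left ?_ (by positivity)
          have : 0 ≤ 320 * CG ^ 2 * Q := by positivity
          nlinarith
      _ = C * A * (B + Q) := by rw [hC]; ring
  have hfin := le_of_sq_le_mul_add (by positivity) hsq
  have hAle : A ≤ (N : ℝ) ^ (4 - 3 * δ / 8) :=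
    Real.rpow_le_rpow_of_exponent_le hN1 (by linarith)
  -- In `A B` the powers of `κ` cancel: the exponent is `8 - 3 δ / 4`, with square root `4 - 3 δ /
  -- 8`.
  have hAB : C * A * B = C * ((N : ℝ) ^ (4 - 3 * δ / 8)) ^ 2 := by
    rw [mul_assoc, hA, hB, ← Real.rpow_add hN0, ← Real.rpow_natCast, ← Real.rpow_mul hN0.le]
    congr 2; push_cast; ring
  rw [hAB, Real.sqrt_mul hC0.le, Real.sqrt_sq (by positivity)] at hfin
  calc Q ≤ _ := hfin
    _ ≤ C * (N : ℝ) ^ (4 - 3 * δ / 8) + Real.sqrt C * (N : ℝ) ^ (4 - 3 * δ / 8) := by gcongr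
    _ = _ := by ring

lemma gap_pos {x : ℕ → ℝ} {c η : ℝ} (hc : 0 < c) (hη1 : η ≤ 1)
    (hspacing : ∀ n : ℕ, 1 ≤ n → c / (n : ℝ) ^ (1 - η) ≤ x (n + 1) - x n) {N : ℕ}
    {p : ℕ × ℕ} (hp : p ∈ ltPairs N) : 0 < gap x p := by
  refine lt_of_lt_of_le ?_ (le_gap hc hη1 hspacing hp)
  obtain ⟨h1, h2, h3⟩ := mem_ltPairs.1 hp
  have hN : (0 : ℝ) < N := by exact_mod_cast (by omega : 0 < N)
  have h4 : (0 : ℝ) < ((p.2 - p.1 : ℕ) : ℝ) := by exact_mod_cast (by omega : 0 < p.2 - p.1)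
  positivity

/-- Power saving in the full count. -/
theorem exists_ratioCount_le {x : ℕ → ℝ} {c η : ℝ} (hc : 0 < c) (hη : 2 / 3 < η) (hη1 : η ≤ 1)
    (hspacing : ∀ n : ℕ, 1 ≤ n → c / (n : ℝ) ^ (1 - η) ≤ x (n + 1) - x n)
    {δ κ : ℝ} (hδ : 0 < δ) (hκ : 0 ≤ κ)
    (henergy : (fun N : ℕ => (approxEnergy x N (1 / (N : ℝ)) : ℝ))
      =O[atTop] (fun N : ℕ => (N : ℝ) ^ (3 - κ - δ)))
    (hgrowth : (fun N : ℕ => gapSum x N)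
      =O[atTop] (fun N : ℕ => (N : ℝ) ^ (1 + κ / 2))) :
    ∃ τ : ℝ, 0 < τ ∧ τ ≤ 1 ∧ ∃ C : ℝ, 0 < C ∧ ∀ᶠ N : ℕ in atTop,
      (ratioCount (ltPairs N) (gap x) N : ℝ) ≤ C * (N : ℝ) ^ (4 - τ) := by
  obtain ⟨C, hC, hmain⟩ := exists_ratioCount_filter_le hδ hκ henergy hgrowth
  -- Small gaps contribute `N ^ (5 - 2 η)` times a squared logarithm, for which `N ^ (1 / 6)` is
  -- allowed. Since `η > 2 / 3`, the total exponent is below `11 / 3 + 1 / 6 = 4 - 1 / 6`.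
  refine ⟨min (3 * δ / 8) (1 / 6), by positivity, (min_le_right _ _).trans (by norm_num),
    C + 6 * (13 / c) ^ 2, by positivity, ?_⟩
  filter_upwards [hmain, eventually_ge_atTop 1] with N hQ hN
  have hN1 : (1 : ℝ) ≤ N := by exact_mod_cast hN
  have hN0 : (0 : ℝ) < N := by linarith
  have h1 := ratioCount_gap_le (x := x) (N := N) (fun p hp => gap_pos hc hη1 hspacing hp)
  have h2 := sum_inv_gap_le hc hη1 hspacing hN
  have h3 := one_add_log_le_rpow hN1 (by norm_num : (0 : ℝ) < 1 / 12)
  have h0 : 0 ≤ ∑ p ∈ ltPairs N, (gap x p)⁻¹ :=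
    Finset.sum_nonneg fun p hp => (inv_pos.2 (gap_pos hc hη1 hspacing hp)).le
  have hlog : 0 ≤ Real.log N := Real.log_nonneg hN1
  have e1 : N * ((N : ℝ) ^ (1 - η) * (N * (N : ℝ) ^ (1 / 12 : ℝ))) ^ 2
      = (N : ℝ) ^ (5 - 2 * η + 1 / 6) := by
    have : (N : ℝ) * ((N : ℝ) ^ (1 - η) * (N * (N : ℝ) ^ (1 / 12 : ℝ))) ^ 2
      = (N : ℝ) ^ (1 : ℝ) * ((N : ℝ) ^ (1 - η) * ((N : ℝ) ^ (1 : ℝ)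
        * (N : ℝ) ^ (1 / 12 : ℝ))) ^ (2 : ℕ) := by rw [Real.rpow_one]
    rw [this, ← Real.rpow_add hN0, ← Real.rpow_add hN0, ← Real.rpow_natCast,
      ← Real.rpow_mul hN0.le, ← Real.rpow_add hN0]
    congr 1; push_cast; ring
  have hW : 3 * ((N : ℝ) + 1) * (∑ p ∈ ltPairs N, (gap x p)⁻¹) ^ 2
      ≤ 6 * (13 / c) ^ 2 * (N : ℝ) ^ (4 - min (3 * δ / 8) (1 / 6)) := by
    calc _ ≤ 3 * ((N : ℝ) + N) * ((N : ℝ) ^ (1 - η) / c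
          * (N * ((1 + 1 / (1 / 12)) * (N : ℝ) ^ (1 / 12 : ℝ)))) ^ 2 := by
          gcongr
          refine h2.trans ?_
          gcongr
      _ = 6 * (13 / c) ^ 2 * (N * ((N : ℝ) ^ (1 - η) * (N * (N : ℝ) ^ (1 / 12 : ℝ))) ^ 2) := by
          norm_num
          ring
      _ ≤ _ := by
          rw [e1]
          refine mul_le_mul_of_nonneg_left ?_ (by positivity)
          refine Real.rpow_le_rpow_of_exponent_le hN1 ?_
          have := min_le_right (3 * δ / 8) (1 / 6)
          linarith
  have hQ' : (ratioCount ((ltPairs N).filter (fun p => 1 ≤ gap x p)) (gap x) N : ℝ)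
      ≤ C * (N : ℝ) ^ (4 - min (3 * δ / 8) (1 / 6)) := by
    refine hQ.trans (mul_le_mul_of_nonneg_left ?_ hC.le)
    refine Real.rpow_le_rpow_of_exponent_le hN1 ?_
    have := min_le_left (3 * δ / 8) (1 / 6)
    linarith
  calc _ ≤ _ := h1
    _ ≤ _ := add_le_add hQ' hW
    _ = _ := by ring

/-! ### Gaussian mean squares and almost everywhere convergence -/

lemma summable_inv_one_add_int_sq : Summable (fun h : ℤ => (1 + (h : ℝ) ^ 2)⁻¹) := by
  refine Summable.of_norm_bounded_eventually (g := fun h : ℤ => 1 / (h : ℝ) ^ 2)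
    (Real.summable_one_div_int_pow.2 one_lt_two) ?_
  filter_upwards [(Set.finite_singleton (0 : ℤ)).compl_mem_cofinite] with h hh
  have h0 : (h : ℝ) ≠ 0 := by exact_mod_cast hh
  rw [Real.norm_of_nonneg (by positivity), one_div]
  exact inv_anti₀ (by positivity) (by linarith)

/-- By Cauchy–Schwarz an autocorrelation is largest at shift zero. -/
lemma coincidences_add_le {ι : Type*} (I : Finset ι) (f : ι → ℤ) (h : ℤ) :
    coincidences I I f (fun j => f j + h) ≤ coincidences I I f f := by
  have h1 := coincidences_sq_le I I f (fun j => f j + h)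
  have h2 : coincidences I I (fun j => f j + h) (fun j => f j + h) = coincidences I I f f := by
    unfold coincidences; simp
  rw [h2, ← sq] at h1
  exact (Nat.pow_le_pow_iff_left two_ne_zero).1 h1

/-- The floors' difference `h` is within 1 of `d = a - b`, so `1 + h² ≤ 3 + 2 d² ≤ 3 (1 + π d²) ≤ 3
exp (π d²)`. The right side depends on the integer `h` alone and is summable in it. -/
lemma exp_neg_pi_sq_le_floor (a b : ℝ) :
    Real.exp (-Real.pi * (a - b) ^ 2)
      ≤ 3 * (1 + (((⌊a⌋ - ⌊b⌋ : ℤ)) : ℝ) ^ 2)⁻¹ := by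
  have h1 := Int.floor_le a
  have h2 := Int.lt_floor_add_one a
  have h3 := Int.floor_le b
  have h4 := Int.lt_floor_add_one b
  have hpi := Real.pi_gt_three
  set d := a - b with hd
  push_cast
  set h : ℝ := (⌊a⌋ : ℝ) - ⌊b⌋ with hh
  have h5 : |h - d| ≤ 1 := abs_le.2 ⟨by linarith, by linarith⟩
  have h6 : (h - d) ^ 2 ≤ 1 := by
    rw [← sq_abs]; nlinarith [abs_nonneg (h - d)]
  have h7 : h ^ 2 ≤ 2 * d ^ 2 + 2 := by nlinarith [sq_nonneg (h - 2 * d)]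
  have h8 : 1 + Real.pi * d ^ 2 ≤ Real.exp (Real.pi * d ^ 2) := by
    linarith [Real.add_one_le_exp (Real.pi * d ^ 2)]
  rw [neg_mul, Real.exp_neg, ← div_eq_mul_inv, le_div_iff₀ (by positivity),
    inv_mul_le_iff₀ (Real.exp_pos _)]
  nlinarith [sq_nonneg d]

/-- Gaussian-weighted pair sums are controlled by the number of near pairs. -/
lemma sum_exp_neg_pi_sq_le {ι : Type*} (I : Finset ι) (t : ι → ℝ) :
    ∑ i ∈ I, ∑ j ∈ I, Real.exp (-Real.pi * (t i - t j) ^ 2)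
      ≤ 3 * (∑' h : ℤ, (1 + (h : ℝ) ^ 2)⁻¹) * nearPairs I t 1 := by
  classical
  have hE : coincidences I I (fun i => ⌊t i⌋) (fun i => ⌊t i⌋) ≤ nearPairs I t 1 := by
    have := coincidences_floor_le_nearPairs I t one_pos
    simpa using this
  set f : ι → ℤ := fun i => ⌊t i⌋ with hf
  set H : Finset ℤ := (I ×ˢ I).image (fun p => f p.1 - f p.2) with hH
  calc ∑ i ∈ I, ∑ j ∈ I, Real.exp (-Real.pi * (t i - t j) ^ 2)
      ≤ ∑ i ∈ I, ∑ j ∈ I, 3 * (1 + (((f i - f j : ℤ)) : ℝ) ^ 2)⁻¹ :=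
        Finset.sum_le_sum fun i _ => Finset.sum_le_sum fun j _ => exp_neg_pi_sq_le_floor _ _
    _ = 3 * ∑ p ∈ I ×ˢ I, (1 + (((f p.1 - f p.2 : ℤ)) : ℝ) ^ 2)⁻¹ := by
        rw [Finset.sum_product, Finset.mul_sum]
        simp only [Finset.mul_sum]
    _ = 3 * ∑ h ∈ H, (((I ×ˢ I).filter (fun p : ι × ι => f p.1 - f p.2 = h)).card : ℝ)
          * (1 + (h : ℝ) ^ 2)⁻¹ := by
        congr 1
        rw [← Finset.sum_fiberwise_of_maps_to (s := I ×ˢ I) (t := H)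
          (g := fun p : ι × ι => f p.1 - f p.2)
          (fun p hp => Finset.mem_image_of_mem (fun p : ι × ι => f p.1 - f p.2) hp)]
        refine Finset.sum_congr rfl fun h _ => ?_
        rw [Finset.sum_congr rfl (g := fun _ => (1 + (h : ℝ) ^ 2)⁻¹)
          (fun p hp => by rw [(Finset.mem_filter.1 hp).2])]
        simp
    _ ≤ 3 * ∑ h ∈ H, (nearPairs I t 1 : ℝ) * (1 + (h : ℝ) ^ 2)⁻¹ := by
        gcongr with h _
        refine le_trans ?_ ((coincidences_add_le I f h).trans hE)
        refine Finset.card_le_card fun p hp => ?_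
        simp only [Finset.mem_filter] at hp ⊢
        exact ⟨hp.1, by omega⟩
    _ = 3 * (∑ h ∈ H, (1 + (h : ℝ) ^ 2)⁻¹) * nearPairs I t 1 := by
        rw [← Finset.mul_sum]; ring
    _ ≤ _ := by
        gcongr
        exact summable_inv_one_add_int_sq.sum_le_tsum _ (fun _ _ => by positivity)

/-- The exponential sum with coefficients `c` and frequencies `t`. -/
noncomputable def expSum {ι : Type*} (I : Finset ι) (c : ι → ℂ) (t : ι → ℝ) (α : ℝ) : ℂ :=
  ∑ i ∈ I, c i * Complex.exp (2 * Real.pi * Complex.I * (t i * α : ℝ))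

/-- The Gaussian is its own Fourier transform. As a weight it is positive on the whole line, so no
localisation in `α` is needed, and the off-diagonal terms of a mean square come out nonnegative and
rapidly decaying. -/
lemma integral_gaussian_mul_exp (s : ℝ) :
    Integrable (fun α : ℝ => Complex.exp (2 * Real.pi * Complex.I * (s * α : ℝ))
        * Complex.exp (-Real.pi * (α : ℂ) ^ 2)) ∧
    ∫ α : ℝ, Complex.exp (2 * Real.pi * Complex.I * (s * α : ℝ))
        * Complex.exp (-Real.pi * (α : ℂ) ^ 2) = (Real.exp (-Real.pi * s ^ 2) : ℂ) := by
  have hpi : 0 < ((Real.pi : ℂ)).re := by simpa using Real.pi_pos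
  have hpi0 : (Real.pi : ℂ) ≠ 0 := by exact_mod_cast Real.pi_ne_zero
  constructor
  · have h := integrable_cexp_quadratic hpi (2 * Real.pi * Complex.I * s) 0
    convert! h using 2 with α
    rw [← Complex.exp_add]
    congr 1
    push_cast; ring
  · have h := fourierIntegral_gaussian hpi (2 * Real.pi * s)
    rw [div_self hpi0, Complex.one_cpow, one_mul] at h
    convert! h using 2
    · ext α
      congr 2
      push_cast; ring
    · push_cast
      congr 1
      field_simp
      ring

/-- Mean square of an exponential sum against the Gaussian weight. -/
theorem integral_gaussian_mul_norm_expSum_sq_le {ι : Type*} (I : Finset ι) (c : ι → ℂ)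
    (t : ι → ℝ) {B : ℝ} (hc : ∀ i ∈ I, ‖c i‖ ≤ B) :
    Integrable (fun α : ℝ => Real.exp (-Real.pi * α ^ 2) * ‖expSum I c t α‖ ^ 2) ∧
    ∫ α : ℝ, Real.exp (-Real.pi * α ^ 2) * ‖expSum I c t α‖ ^ 2
      ≤ 3 * (∑' h : ℤ, (1 + (h : ℝ) ^ 2)⁻¹) * B ^ 2 * nearPairs I t 1 := by
  have hexp : ∀ α : ℝ, ((Real.exp (-Real.pi * α ^ 2) * ‖expSum I c t α‖ ^ 2 : ℝ) : ℂ)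
      = ∑ i ∈ I, ∑ j ∈ I, (c i * (starRingEnd ℂ) (c j)) *
        (Complex.exp (2 * Real.pi * Complex.I * ((t i - t j) * α : ℝ))
        * Complex.exp (-Real.pi * (α : ℂ) ^ 2)) := by
    intro α
    push_cast
    rw [← Complex.mul_conj', expSum, map_sum, Finset.sum_mul_sum, Finset.mul_sum]
    refine Finset.sum_congr rfl fun i _ => ?_
    rw [Finset.mul_sum]
    refine Finset.sum_congr rfl fun j _ => ?_
    rw [map_mul, ← Complex.exp_conj]
    have : Complex.exp (2 * Real.pi * Complex.I * ((t i - t j) * α))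
        = Complex.exp (2 * Real.pi * Complex.I * (t i * α : ℝ))
          * Complex.exp ((starRingEnd ℂ) (2 * Real.pi * Complex.I * (t j * α : ℝ))) := by
      rw [← Complex.exp_add]
      congr 1
      simp only [map_mul, Complex.conj_I, Complex.conj_ofReal, map_ofNat]
      push_cast
      ring
    rw [this]
    ring
  have hint : ∀ i ∈ I, ∀ j ∈ I, Integrable (fun α : ℝ => (c i * (starRingEnd ℂ) (c j)) *
        (Complex.exp (2 * Real.pi * Complex.I * ((t i - t j) * α : ℝ))
        * Complex.exp (-Real.pi * (α : ℂ) ^ 2))) := fun i _ j _ =>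
    (integral_gaussian_mul_exp (t i - t j)).1.const_mul _
  have hIntC : Integrable
      (fun α : ℝ => ((Real.exp (-Real.pi * α ^ 2) * ‖expSum I c t α‖ ^ 2 : ℝ) : ℂ)) := by
    simp_rw [hexp]
    exact integrable_finsetSum _ fun i hi => integrable_finsetSum _ fun j hj => hint i hi j hj
  refine ⟨by simpa only [RCLike.re_to_complex, Complex.ofReal_re] using hIntC.re, ?_⟩
  have hval : ((∫ α : ℝ, Real.exp (-Real.pi * α ^ 2) * ‖expSum I c t α‖ ^ 2 : ℝ) : ℂ)
      = ∑ i ∈ I, ∑ j ∈ I, (c i * (starRingEnd ℂ) (c j))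
        * (Real.exp (-Real.pi * (t i - t j) ^ 2) : ℂ) := by
    rw [← integral_complex_ofReal]
    simp_rw [hexp]
    rw [integral_finsetSum _ fun i hi => integrable_finsetSum _ fun j hj => hint i hi j hj]
    refine Finset.sum_congr rfl fun i hi => ?_
    rw [integral_finsetSum _ fun j hj => hint i hi j hj]
    refine Finset.sum_congr rfl fun j hj => ?_
    rw [integral_const_mul, (integral_gaussian_mul_exp (t i - t j)).2]
  calc _ ≤ ‖((∫ α : ℝ, Real.exp (-Real.pi * α ^ 2) * ‖expSum I c t α‖ ^ 2 : ℝ) : ℂ)‖ := by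
        rw [Complex.norm_real]; exact le_abs_self _
    _ ≤ ∑ i ∈ I, ∑ j ∈ I, B ^ 2 * Real.exp (-Real.pi * (t i - t j) ^ 2) := by
        rw [hval]
        refine (norm_sum_le _ _).trans (Finset.sum_le_sum fun i hi => ?_)
        refine (norm_sum_le _ _).trans (Finset.sum_le_sum fun j hj => ?_)
        rw [norm_mul, norm_mul, RCLike.norm_conj, Complex.norm_real,
          Real.norm_of_nonneg (Real.exp_pos _).le, sq B]
        have h1 := hc i hi
        have h2 := hc j hj
        have : 0 ≤ B := (norm_nonneg _).trans (hc i hi)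
        refine mul_le_mul_of_nonneg_right ?_ (Real.exp_pos _).le
        exact mul_le_mul h1 h2 (norm_nonneg _) this
    _ = B ^ 2 * ∑ i ∈ I, ∑ j ∈ I, Real.exp (-Real.pi * (t i - t j) ^ 2) := by
        simp only [Finset.mul_sum]
    _ ≤ B ^ 2 * (3 * (∑' h : ℤ, (1 + (h : ℝ) ^ 2)⁻¹) * nearPairs I t 1) := by
        gcongr
        exact sum_exp_neg_pi_sq_le I t
    _ = _ := by ring

/-- Nonnegative functions with summable integrals tend to zero almost everywhere. -/
lemma ae_tendsto_zero_of_summable_integral {F : ℕ → ℝ → ℝ} {a : ℕ → ℝ}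
    (hF0 : ∀ m α, 0 ≤ F m α) (hint : ∀ m, Integrable (F m))
    (hle : ∀ m, ∫ α, F m α ≤ a m) (ha : Summable a) :
    ∀ᵐ α : ℝ, Tendsto (fun m => F m α) atTop (𝓝 0) := by
  -- By Tonelli the sum of all `F m` has finite integral, hence is finite almost everywhere, and the
  -- terms of a convergent series tend to zero.
  have h1 : ∫⁻ α, ∑' m, ENNReal.ofReal (F m α) ≠ ⊤ := by
    rw [lintegral_tsum fun m => (hint m).1.aemeasurable.ennreal_ofReal]
    have h2 : ∀ m, ∫⁻ α, ENNReal.ofReal (F m α) ≤ ENNReal.ofReal (a m) := fun m => by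
      rw [← ofReal_integral_eq_lintegral_ofReal (hint m) (ae_of_all _ (hF0 m))]
      exact ENNReal.ofReal_le_ofReal (hle m)
    refine ne_top_of_le_ne_top ?_ (ENNReal.tsum_le_tsum h2)
    exact ha.tsum_ofReal_ne_top
  filter_upwards [ae_lt_top' (AEMeasurable.tsum fun m =>
    (hint m).1.aemeasurable.ennreal_ofReal) h1] with α hα
  have h3 := ENNReal.tendsto_atTop_zero_of_tsum_ne_top hα.ne
  have h4 := (ENNReal.tendsto_toReal ENNReal.zero_ne_top).comp h3
  simpa [Function.comp_def, ENNReal.toReal_ofReal (hF0 _ _)] using h4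
-- Poisson summation for the periodised bump
open scoped FourierTransform SchwartzMap ContDiff

/-- A bump function on the line as a complex Schwartz function. -/
noncomputable def bumpSchwartz (b : ContDiffBump (0 : ℝ)) : 𝓢(ℝ, ℂ) :=
  HasCompactSupport.toSchwartzMap (f := fun u => (b u : ℂ))
    (b.hasCompactSupport.comp_left (g := ((↑) : ℝ → ℂ)) Complex.ofReal_zero)
    (Complex.ofRealCLM.contDiff.comp b.contDiff)

@[simp]
lemma bumpSchwartz_apply (b : ContDiffBump (0 : ℝ)) (u : ℝ) : bumpSchwartz b u = (b u : ℂ) := rfl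

/-- The function `y ↦ ∑ₙ b (N (y + n))`. -/
noncomputable def periodization (b : ContDiffBump (0 : ℝ)) (N : ℝ) (y : ℝ) : ℝ :=
  ∑' n : ℤ, b (N * (y + n))

/-- The Fourier coefficients of `periodization b N`. -/
noncomputable def periodCoeff (b : ContDiffBump (0 : ℝ)) (N : ℝ) (k : ℤ) : ℂ :=
  (N : ℂ)⁻¹ * (𝓕 (bumpSchwartz b)) (k / N)

lemma periodCoeff_zero (b : ContDiffBump (0 : ℝ)) (N : ℝ) :
    periodCoeff b N 0 = ((N⁻¹ * ∫ u, b u : ℝ) : ℂ) := by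
  unfold periodCoeff
  rw [Int.cast_zero, zero_div, SchwartzMap.fourier_coe, Real.fourier_eq']
  push_cast
  congr 1
  rw [← integral_complex_ofReal]
  simp

lemma norm_periodCoeff_le (b : ContDiffBump (0 : ℝ)) (A : ℕ) :
    ∃ C : ℝ, 0 < C ∧ ∀ N : ℝ, 0 < N → ∀ k : ℤ,
      ‖periodCoeff b N k‖ * |(k : ℝ) / N| ^ A ≤ C / N := by
  obtain ⟨C, hC, h⟩ := (𝓕 (bumpSchwartz b)).decay A 0
  refine ⟨C, hC, fun N hN k => ?_⟩
  have h1 := h (k / N)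
  rw [norm_iteratedFDeriv_zero, Real.norm_eq_abs] at h1
  rw [periodCoeff, norm_mul, norm_inv, Complex.norm_real, Real.norm_of_nonneg hN.le]
  calc _ = N⁻¹ * (|(k : ℝ) / N| ^ A * ‖(𝓕 (bumpSchwartz b)) ((k : ℝ) / N)‖) := by ring
    _ ≤ N⁻¹ * C := by gcongr
    _ = C / N := by ring

lemma fourier_scaled (b : ContDiffBump (0 : ℝ)) {N : ℝ} (hN : 0 < N) (w : ℝ) :
    𝓕 (fun u : ℝ => bumpSchwartz b (N * u)) w = (N : ℂ)⁻¹ * (𝓕 (bumpSchwartz b)) (w / N) := by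
  rw [SchwartzMap.fourier_coe, Real.fourier_eq', Real.fourier_eq']
  have h := Measure.integral_comp_mul_left (fun v : ℝ =>
    Complex.exp (↑(-2 * Real.pi * inner ℝ v (w / N)) * Complex.I) • bumpSchwartz b v) N
  rw [abs_of_pos (inv_pos.2 hN), ← Complex.coe_smul, smul_eq_mul, Complex.ofReal_inv] at h
  rw [← h]
  congr 1
  ext u
  congr 4
  simp only [RCLike.inner_apply, conj_trivial]
  field_simp

/-- Poisson summation for the Schwartz function `u ↦ b (N u)`. -/
lemma ofReal_periodization (b : ContDiffBump (0 : ℝ)) {N : ℝ} (hN : 0 < N) (y : ℝ) :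
    ((periodization b N y : ℝ) : ℂ)
      = ∑' k : ℤ, periodCoeff b N k * Complex.exp (2 * Real.pi * Complex.I * (k * y : ℝ)) := by
  set Ψ : 𝓢(ℝ, ℂ) := SchwartzMap.compCLMOfContinuousLinearEquiv ℂ
    (ContinuousLinearEquiv.unitsEquivAut ℝ (Units.mk0 N hN.ne')) (bumpSchwartz b) with hΨ
  have hcoe : (Ψ : ℝ → ℂ) = fun u => bumpSchwartz b (N * u) := by
    ext u
    simp [hΨ, mul_comm]
  have h := Ψ.tsum_eq_tsum_fourier y
  rw [periodization, Complex.ofReal_tsum]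
  have h1 : ∀ n : ℤ, Ψ (y + n) = ((b (N * (y + n)) : ℝ) : ℂ) := by
    intro n
    rw [hcoe]
    rfl
  simp_rw [h1] at h
  rw [h]
  refine tsum_congr fun k => ?_
  rw [SchwartzMap.fourier_coe, hcoe, fourier_scaled b hN, fourier_coe_apply, periodCoeff]
  congr 2
  push_cast
  ring

/-- The nonzero integers of absolute value at most `K`. -/
noncomputable def nonzeroIcc (K : ℕ) : Finset ℤ := (Finset.Icc (-(K : ℤ)) K).erase 0

lemma mem_nonzeroIcc {K : ℕ} {k : ℤ} : k ∈ nonzeroIcc K ↔ k ≠ 0 ∧ k.natAbs ≤ K := by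
  simp only [nonzeroIcc, Finset.mem_erase, Finset.mem_Icc]
  omega

/-- Truncated Poisson summation. -/
lemma exists_norm_periodization_sub_le (b : ContDiffBump (0 : ℝ)) (A : ℕ) :
    ∃ C : ℝ, 0 < C ∧ ∀ N : ℝ, 1 ≤ N → ∀ K : ℕ, 1 ≤ K → ∀ y : ℝ,
      ‖((periodization b N y : ℝ) : ℂ) - ((N⁻¹ * ∫ u, b u : ℝ) : ℂ)
        - ∑ k ∈ nonzeroIcc K,
          periodCoeff b N k * Complex.exp (2 * Real.pi * Complex.I * (k * y : ℝ))‖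
        ≤ C * (N ^ (A + 2) / (K : ℝ) ^ A) := by
  -- Of the `A + 2` powers of decay, two make the sum over `k` converge and `A` give the factor `K ^
  -- (-A)`.
  obtain ⟨C, hC, hdec⟩ := norm_periodCoeff_le b (A + 2)
  have hsumm : Summable (fun k : ℤ => 1 / (k : ℝ) ^ 2) :=
    Real.summable_one_div_int_pow.2 one_lt_two
  set M := ∑' k : ℤ, 1 / (k : ℝ) ^ 2 with hM
  have hM0 : 0 ≤ M := tsum_nonneg fun k => by positivity
  refine ⟨C * (M + 1), by positivity, fun N hN K hK y => ?_⟩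
  have hN0 : 0 < N := by linarith
  have hK0 : (0 : ℝ) < K := by exact_mod_cast hK
  set f : ℤ → ℂ := fun k =>
    periodCoeff b N k * Complex.exp (2 * Real.pi * Complex.I * (k * y : ℝ)) with hf
  have hnorm : ∀ k, ‖f k‖ = ‖periodCoeff b N k‖ := by
    intro k
    rw [hf]
    simp only [norm_mul]
    rw [show (2 * Real.pi * Complex.I * ((k * y : ℝ) : ℂ) : ℂ)
      = ((2 * Real.pi * (k * y) : ℝ) : ℂ) * Complex.I by push_cast; ring,
      Complex.norm_exp_ofReal_mul_I, mul_one]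
  have hbound : ∀ T : ℝ, 0 < T → ∀ k : ℤ, T ≤ |(k : ℝ)| →
      ‖f k‖ ≤ C * (N ^ (A + 2) / T ^ A) * (1 / (k : ℝ) ^ 2) := by
    intro T hT k hk
    have hk0 : 0 < |(k : ℝ)| := hT.trans_le hk
    have h1 := hdec N hN0 k
    rw [abs_div, abs_of_pos hN0, div_pow, mul_div_assoc', div_le_iff₀ (by positivity)] at h1
    rw [hnorm]
    calc ‖periodCoeff b N k‖
        = ‖periodCoeff b N k‖ * |(k : ℝ)| ^ (A + 2) / |(k : ℝ)| ^ (A + 2) := by field_simp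
      _ ≤ C / N * N ^ (A + 2) / |(k : ℝ)| ^ (A + 2) := by gcongr
      _ ≤ C / 1 * N ^ (A + 2) / (T ^ A * |(k : ℝ)| ^ 2) := by
          rw [pow_add |(k : ℝ)|]
          gcongr
      _ = _ := by rw [sq_abs]; field_simp
  have hfs : Summable f := by
    refine Summable.of_norm_bounded_eventually (hsumm.mul_left (C * (N ^ (A + 2) / 1 ^ A))) ?_
    filter_upwards [(Set.finite_singleton (0 : ℤ)).compl_mem_cofinite] with k hk
    refine hbound 1 one_pos k ?_
    have : 1 ≤ |k| := Int.one_le_abs hk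
    exact_mod_cast this
  have hsplit := hfs.sum_add_tsum_compl (s := Finset.Icc (-(K : ℤ)) K)
  rw [ofReal_periodization b hN0 y, ← hsplit]
  have h0 : f 0 = ((N⁻¹ * ∫ u, b u : ℝ) : ℂ) := by
    rw [hf]
    simp only [Int.cast_zero, zero_mul, Complex.ofReal_zero, mul_zero, Complex.exp_zero, mul_one]
    exact periodCoeff_zero b N
  have hIcc : ∑ k ∈ Finset.Icc (-(K : ℤ)) K, f k = ∑ k ∈ nonzeroIcc K, f k + f 0 :=
    (Finset.sum_erase_add _ _ (by rw [Finset.mem_Icc]; omega)).symm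
  rw [hIcc, h0, show ∀ a e c : ℂ, a + e + c - e - a = c from fun a e c => by ring]
  have hD0 : 0 ≤ C * (N ^ (A + 2) / (K : ℝ) ^ A) := by positivity
  set S : Set ℤ := ((Finset.Icc (-(K : ℤ)) K : Finset ℤ) : Set ℤ)ᶜ with hS
  have hsub : Summable (fun k : S => C * (N ^ (A + 2) / (K : ℝ) ^ A) * (1 / ((k : ℤ) : ℝ) ^ 2)) :=
    (hsumm.mul_left _).subtype S
  calc ‖∑' k : S, f k‖
      ≤ ∑' k : S, C * (N ^ (A + 2) / (K : ℝ) ^ A) * (1 / ((k : ℤ) : ℝ) ^ 2) := by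
        refine tsum_of_norm_bounded hsub.hasSum fun k => hbound K hK0 k ?_
        have hk : (k : ℤ) ∈ ((Finset.Icc (-(K : ℤ)) K : Finset ℤ) : Set ℤ)ᶜ := k.2
        rw [Set.mem_compl_iff, Finset.mem_coe, Finset.mem_Icc] at hk
        have : (K : ℤ) ≤ |(k : ℤ)| := by
          by_contra! h
          exact hk (abs_le.1 h.le)
        exact_mod_cast this
    _ ≤ ∑' k : ℤ, C * (N ^ (A + 2) / (K : ℝ) ^ A) * (1 / (k : ℝ) ^ 2) :=
        Summable.tsum_subtype_le (fun k : ℤ => C * (N ^ (A + 2) / (K : ℝ) ^ A)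
          * (1 / (k : ℝ) ^ 2)) S (fun k => by positivity) (hsumm.mul_left _)
    _ = C * (N ^ (A + 2) / (K : ℝ) ^ A) * M := by rw [tsum_mul_left]
    _ ≤ C * (M + 1) * (N ^ (A + 2) / (K : ℝ) ^ A) := by
        have : 0 ≤ C * (N ^ (A + 2) / (K : ℝ) ^ A) := hD0
        nlinarith

/-- The pairs `1 ≤ n₁ ≠ n₂ ≤ N`. -/
def nePairs (N : ℕ) : Finset (ℕ × ℕ) :=
  (Finset.Icc 1 N ×ˢ Finset.Icc 1 N).filter (fun p => p.1 ≠ p.2)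

lemma mem_nePairs {N : ℕ} {p : ℕ × ℕ} :
    p ∈ nePairs N ↔ (1 ≤ p.1 ∧ p.1 ≤ N) ∧ (1 ≤ p.2 ∧ p.2 ≤ N) ∧ p.1 ≠ p.2 := by
  simp only [nePairs, Finset.mem_filter, Finset.mem_product, Finset.mem_Icc]
  tauto

lemma card_nePairs (N : ℕ) : (nePairs N).card = N * N - N := by
  have : nePairs N = (Finset.Icc 1 N).offDiag := by
    ext p
    simp only [nePairs, Finset.mem_filter, Finset.mem_product, Finset.mem_offDiag]
    tauto
  rw [this, Finset.offDiag_card]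
  simp

/-- Reordering a pair increasingly. -/
def sortPair (p : ℕ × ℕ) : ℕ × ℕ := (min p.1 p.2, max p.1 p.2)

lemma sortPair_mem {N K : ℕ} (hNK : N ≤ K) {p : ℕ × ℕ} (hp : p ∈ nePairs N) :
    sortPair p ∈ ltPairs K := by
  have := mem_nePairs.1 hp
  rw [mem_ltPairs, sortPair]
  simp only
  omega

lemma gap_sortPair {x : ℕ → ℝ} {K : ℕ} (hpos : ∀ p ∈ ltPairs K, 0 < gap x p) {N : ℕ}
    (hNK : N ≤ K) {p : ℕ × ℕ} (hp : p ∈ nePairs N) : gap x (sortPair p) = |gap x p| := by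
  have h := hpos _ (sortPair_mem hNK hp)
  rcases le_total p.1 p.2 with h1 | h1
  · have e : sortPair p = p := by rw [sortPair, min_eq_left h1, max_eq_right h1]
    rw [e] at h ⊢
    rw [abs_of_pos h]
  · have e : sortPair p = p.swap := by rw [sortPair, min_eq_right h1, max_eq_left h1]; rfl
    have e2 : gap x p.swap = -gap x p := by simp [gap]
    rw [e, e2] at h ⊢
    rw [abs_of_neg (by linarith)]

lemma ratioCount_eq_card {ι : Type*} (I : Finset ι) (z : ι → ℝ) (N : ℕ) :
    ratioCount I z N = (((Finset.Icc 1 N ×ˢ I) ×ˢ (Finset.Icc 1 N ×ˢ I)).filter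
      (fun q : (ℕ × ι) × (ℕ × ι) => |(q.1.1 : ℝ) * z q.1.2 - q.2.1 * z q.2.2| < 1)).card := by
  rw [Finset.card_filter, Finset.sum_product, Finset.sum_product, Finset.sum_comm, ratioCount]
  refine Finset.sum_congr rfl fun i _ => ?_
  simp_rw [Finset.sum_product]
  rw [Finset.sum_congr rfl fun k _ => Finset.sum_comm, Finset.sum_comm]
  refine Finset.sum_congr rfl fun j _ => ?_
  rw [stripCount, Finset.card_filter, Finset.sum_product]

/-- Passing from signed frequencies to positive ones. -/
lemma nearPairs_signed_le {x : ℕ → ℝ} {N K : ℕ} (hpos : ∀ p ∈ ltPairs K, 0 < gap x p)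
    (hNK : N ≤ K) :
    nearPairs (nonzeroIcc K ×ˢ nePairs N) (fun q => (q.1 : ℝ) * gap x q.2) 1
      ≤ 16 * ratioCount (ltPairs K) (gap x) K := by
  classical
  rw [ratioCount_eq_card]
  -- Four bits are lost on passing to `|k|`, `|l|` and sorted pairs: two signs and two orderings.
  -- Recording them makes the map injective; near pairs stay near because `||a| - |b|| ≤ |a - b|`.
  have hB : (Finset.univ : Finset ((Bool × Bool) × (Bool × Bool))).card = 16 := rfl
  rw [← hB, ← Finset.card_product, nearPairs]
  refine Finset.card_le_card_of_injOn (fun q =>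
    (((decide (0 < q.1.1), decide (q.1.2.1 < q.1.2.2)),
      (decide (0 < q.2.1), decide (q.2.2.1 < q.2.2.2))),
      ((q.1.1.natAbs, sortPair q.1.2), (q.2.1.natAbs, sortPair q.2.2)))) ?_ ?_
  · rintro ⟨⟨k, p⟩, l, q⟩ h
    rw [Finset.mem_coe, Finset.mem_filter, Finset.mem_product, Finset.mem_product,
      Finset.mem_product] at h
    obtain ⟨⟨⟨hk, hp⟩, hl, hq⟩, hlt⟩ := h
    simp only at hk hp hl hq hlt
    rw [mem_nonzeroIcc] at hk hl
    rw [Finset.mem_coe, Finset.mem_product]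
    refine ⟨Finset.mem_univ _, ?_⟩
    simp only [Finset.mem_filter, Finset.mem_product, Finset.mem_Icc]
    refine ⟨⟨⟨by omega, sortPair_mem hNK hp⟩, by omega, sortPair_mem hNK hq⟩, ?_⟩
    rw [gap_sortPair hpos hNK hp, gap_sortPair hpos hNK hq, Nat.cast_natAbs, Nat.cast_natAbs,
      Int.cast_abs, Int.cast_abs, ← abs_mul, ← abs_mul]
    exact (abs_abs_sub_abs_le_abs_sub _ _).trans_lt hlt
  · have aux : ∀ (k k' : ℤ) (p p' : ℕ × ℕ), k ≠ 0 → k' ≠ 0 → p.1 ≠ p.2 → p'.1 ≠ p'.2 →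
        (0 < k ↔ 0 < k') → (p.1 < p.2 ↔ p'.1 < p'.2) → k.natAbs = k'.natAbs →
        sortPair p = sortPair p' → k = k' ∧ p = p' := by
      intro k k' p p' hk hk' hp hp' h1 h2 h3 h4
      simp only [sortPair, Prod.mk.injEq] at h4
      refine ⟨by omega, Prod.ext (by omega) (by omega)⟩
    rintro ⟨⟨k, p⟩, l, q⟩ h ⟨⟨k', p'⟩, l', q'⟩ h' he
    rw [Finset.mem_coe, Finset.mem_filter, Finset.mem_product, Finset.mem_product,
      Finset.mem_product] at h h'
    simp only [mem_nonzeroIcc, mem_nePairs] at h h'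
    simp only [Prod.mk.injEq, decide_eq_decide] at he
    obtain ⟨⟨⟨e1, e2⟩, e3, e4⟩, ⟨e5, e6⟩, e7, e8⟩ := he
    obtain ⟨a1, a2⟩ := aux k k' p p' h.1.1.1.1 h'.1.1.1.1 h.1.1.2.2.2 h'.1.1.2.2.2 e1 e2 e5 e6
    obtain ⟨a3, a4⟩ := aux l l' q q' h.1.2.1.1 h'.1.2.1.1 h.1.2.2.2.2 h'.1.2.2.2.2 e3 e4 e7 e8
    rw [a1, a2, a3, a4]

/-! ### Variance of the smoothed statistic -/

/-- The smoothed pair correlation statistic. -/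
noncomputable def bumpStat (x : ℕ → ℝ) (b : ContDiffBump (0 : ℝ)) (N : ℕ) (α : ℝ) : ℝ :=
  (N : ℝ)⁻¹ * ∑ p ∈ nePairs N, periodization b N (α * gap x p)

/-- The oscillating part of the smoothed pair correlation statistic. -/
noncomputable def bumpOsc (x : ℕ → ℝ) (b : ContDiffBump (0 : ℝ)) (N K : ℕ) (α : ℝ) : ℂ :=
  expSum (nonzeroIcc K ×ˢ nePairs N) (fun q => periodCoeff b N q.1)
    (fun q => (q.1 : ℝ) * gap x q.2) α

/-- The zero frequency contributes `∫ b / N` for each of the `N² - N` pairs, which after division by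
`N` is the main term. The truncation error per pair is multiplied by at most `N`. -/
lemma exists_bumpStat_sub_le (x : ℕ → ℝ) (b : ContDiffBump (0 : ℝ)) (A : ℕ) :
    ∃ C : ℝ, 0 < C ∧ ∀ N : ℕ, 1 ≤ N → ∀ K : ℕ, 1 ≤ K → ∀ α : ℝ,
      |bumpStat x b N α - (1 - (N : ℝ)⁻¹) * ∫ u, b u|
        ≤ (N : ℝ)⁻¹ * ‖bumpOsc x b N K α‖ + C * ((N : ℝ) ^ (A + 3) / (K : ℝ) ^ A) := by
  obtain ⟨C, hC, h⟩ := exists_norm_periodization_sub_le b A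
  refine ⟨C, hC, fun N hN K hK α => ?_⟩
  have hN1 : (1 : ℝ) ≤ N := by exact_mod_cast hN
  have hN0 : (0 : ℝ) < N := by linarith
  have hK0 : (0 : ℝ) < K := by exact_mod_cast hK
  have hcard : ((nePairs N).card : ℝ) = N * N - N := by
    rw [card_nePairs, Nat.cast_sub (Nat.le_mul_self N), Nat.cast_mul]
  set J := ∫ u, b u with hJ
  have hosc : bumpOsc x b N K α = ∑ p ∈ nePairs N, ∑ k ∈ nonzeroIcc K,
      periodCoeff b N k * Complex.exp (2 * Real.pi * Complex.I * (k * (α * gap x p) : ℝ)) := by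
    rw [bumpOsc, expSum, Finset.sum_product, Finset.sum_comm]
    refine Finset.sum_congr rfl fun p _ => Finset.sum_congr rfl fun k _ => ?_
    congr 4
    ring
  have hid : ((bumpStat x b N α - (1 - (N : ℝ)⁻¹) * J : ℝ) : ℂ)
      = (N : ℂ)⁻¹ * bumpOsc x b N K α + (N : ℂ)⁻¹ * ∑ p ∈ nePairs N,
        (((periodization b N (α * gap x p) : ℝ) : ℂ) - (((N : ℝ)⁻¹ * J : ℝ) : ℂ)
        - ∑ k ∈ nonzeroIcc K, periodCoeff b N k
          * Complex.exp (2 * Real.pi * Complex.I * (k * (α * gap x p) : ℝ))) := by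
    have hNC : (N : ℂ) ≠ 0 := by exact_mod_cast hN0.ne'
    have hcardC : ((nePairs N).card : ℂ) = N * N - N := by exact_mod_cast hcard
    rw [Finset.sum_sub_distrib, Finset.sum_sub_distrib, ← hosc, Finset.sum_const,
      nsmul_eq_mul, hcardC, bumpStat]
    push_cast
    field_simp
    ring
  calc |bumpStat x b N α - (1 - (N : ℝ)⁻¹) * J|
      = ‖((bumpStat x b N α - (1 - (N : ℝ)⁻¹) * J : ℝ) : ℂ)‖ := by
        rw [Complex.norm_real, Real.norm_eq_abs]
    _ ≤ (N : ℝ)⁻¹ * ‖bumpOsc x b N K α‖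
        + (N : ℝ)⁻¹ * ∑ p ∈ nePairs N, C * ((N : ℝ) ^ (A + 2) / (K : ℝ) ^ A) := by
        rw [hid]
        refine (norm_add_le _ _).trans (add_le_add ?_ ?_)
        · rw [norm_mul, norm_inv, Complex.norm_natCast]
        · rw [norm_mul, norm_inv, Complex.norm_natCast]
          gcongr
          exact (norm_sum_le _ _).trans (Finset.sum_le_sum fun p _ => h N hN1 K hK _)
    _ ≤ _ := by
        refine add_le_add le_rfl ?_
        rw [Finset.sum_const, nsmul_eq_mul, hcard]
        calc (N : ℝ)⁻¹ * ((N * N - N) * (C * ((N : ℝ) ^ (A + 2) / (K : ℝ) ^ A)))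
            ≤ (N : ℝ)⁻¹ * ((N * N) * (C * ((N : ℝ) ^ (A + 2) / (K : ℝ) ^ A))) := by
              gcongr; linarith
          _ = _ := by field_simp; ring

/-- Variance bound for the oscillating part. -/
lemma exists_integral_bumpOsc_le (x : ℕ → ℝ) (b : ContDiffBump (0 : ℝ))
    (hpos : ∀ N, ∀ p ∈ ltPairs N, 0 < gap x p) :
    ∃ C : ℝ, 0 < C ∧ ∀ N K : ℕ, 1 ≤ N → N ≤ K →
      Integrable (fun α : ℝ => Real.exp (-Real.pi * α ^ 2) * ‖bumpOsc x b N K α‖ ^ 2) ∧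
      ∫ α : ℝ, Real.exp (-Real.pi * α ^ 2) * ‖bumpOsc x b N K α‖ ^ 2
        ≤ C / (N : ℝ) ^ 2 * ratioCount (ltPairs K) (gap x) K := by
  obtain ⟨C, hC, h⟩ := norm_periodCoeff_le b 0
  set M := ∑' h : ℤ, (1 + (h : ℝ) ^ 2)⁻¹ with hM
  have hM0 : 0 ≤ M := tsum_nonneg fun k => by positivity
  refine ⟨3 * (M + 1) * C ^ 2 * 16, by positivity, fun N K hN hNK => ?_⟩
  have hN0 : (0 : ℝ) < N := by exact_mod_cast hN
  have h1 := integral_gaussian_mul_norm_expSum_sq_le (nonzeroIcc K ×ˢ nePairs N)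
    (fun q => periodCoeff b N q.1) (fun q => (q.1 : ℝ) * gap x q.2) (B := C / N)
    (fun q _ => by simpa using h N hN0 q.1)
  refine ⟨h1.1, h1.2.trans ?_⟩
  have h2 : (nearPairs (nonzeroIcc K ×ˢ nePairs N) (fun q => (q.1 : ℝ) * gap x q.2) 1 : ℝ)
      ≤ 16 * ratioCount (ltPairs K) (gap x) K := by
    exact_mod_cast nearPairs_signed_le (hpos K) hNK
  calc _ ≤ 3 * (M + 1) * (C / N) ^ 2 * (16 * ratioCount (ltPairs K) (gap x) K) := by
        gcongr
        linarith
    _ = _ := by ring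

/-- Almost everywhere convergence of the smoothed statistic along a polynomial subsequence. -/
theorem exists_ae_tendsto_bumpStat (x : ℕ → ℝ) (hpos : ∀ N, ∀ p ∈ ltPairs N, 0 < gap x p)
    {τ C : ℝ} (hτ : 0 < τ) (hτ1 : τ ≤ 1) (hC : 0 < C)
    (hQ : ∀ᶠ N : ℕ in atTop,
      (ratioCount (ltPairs N) (gap x) N : ℝ) ≤ C * (N : ℝ) ^ (4 - τ)) :
    ∃ P : ℕ, 1 ≤ P ∧ ∀ b : ContDiffBump (0 : ℝ), ∀ᵐ α : ℝ,
      Tendsto (fun m : ℕ => bumpStat x b (m ^ P) α) atTop (𝓝 (∫ u, b u)) := by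
  obtain ⟨m₁, hm₁⟩ := eventually_atTop.1 hQ
  set m₀ := max m₁ 1 with hm₀
  -- The normalised variance is `O(N ^ (-τ / 2))`, so at `N = m ^ P` it is `O(m⁻²)`. This `P` does
  -- not depend on the bump.
  set P : ℕ := ⌈4 / τ⌉₊ with hP
  have hPτ : 4 / τ ≤ P := Nat.le_ceil _
  have hP1 : 1 ≤ P := Nat.ceil_pos.2 (by positivity)
  refine ⟨P, hP1, fun b => ?_⟩
  -- Small enough that `(1 + ε) (4 - τ) ≤ 4 - τ / 2`: enlarging `N` to `K` costs half of the saving.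
  set ε : ℝ := τ / 8 with hε
  have hε0 : 0 < ε := by positivity
  -- Then `K ^ A ≥ N ^ (A + 4)`, and the truncation error is `O(1 / N)`.
  set A : ℕ := ⌈4 / ε⌉₊ with hA
  have hAε : 4 ≤ ε * A := by
    have : 4 / ε ≤ A := Nat.le_ceil _
    rwa [div_le_iff₀' hε0] at this
  obtain ⟨C₁, hC₁, hstat⟩ := exists_bumpStat_sub_le x b A
  obtain ⟨C₂, hC₂, hvar⟩ := exists_integral_bumpOsc_le x b hpos
  set K : ℕ → ℕ := fun N => ⌈(N : ℝ) ^ (1 + ε)⌉₊ with hK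
  have hKge : ∀ N : ℕ, (N : ℝ) ^ (1 + ε) ≤ K N := fun N => Nat.le_ceil _
  have hNK : ∀ N : ℕ, 1 ≤ N → N ≤ K N := by
    intro N hN
    have hN1 : (1 : ℝ) ≤ N := by exact_mod_cast hN
    have h1 : (N : ℝ) ≤ (N : ℝ) ^ (1 + ε) := by
      conv_lhs => rw [← Real.rpow_one (N : ℝ)]
      exact Real.rpow_le_rpow_of_exponent_le hN1 (by linarith)
    exact_mod_cast h1.trans (hKge N)
  have hKle : ∀ N : ℕ, 1 ≤ N → (K N : ℝ) ≤ 2 * (N : ℝ) ^ (1 + ε) := by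
    intro N hN
    have hN1 : (1 : ℝ) ≤ N := by exact_mod_cast hN
    have h1 : 1 ≤ (N : ℝ) ^ (1 + ε) := Real.one_le_rpow hN1 (by linarith)
    have h2 := Nat.ceil_lt_add_one (by linarith : 0 ≤ (N : ℝ) ^ (1 + ε))
    linarith
  have hvarN : ∀ N : ℕ, 1 ≤ N → m₁ ≤ N →
      ∫ α : ℝ, ((N : ℝ) ^ 2)⁻¹ *
        (Real.exp (-Real.pi * α ^ 2) * ‖bumpOsc x b N (K N) α‖ ^ 2)
        ≤ C₂ * C * 16 * (N : ℝ) ^ (-(τ / 2)) := by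
    intro N hN hmN
    have hN1 : (1 : ℝ) ≤ N := by exact_mod_cast hN
    have hN0 : (0 : ℝ) < N := by linarith
    rw [integral_const_mul]
    have h1 := (hvar N (K N) hN (hNK N hN)).2
    have h2 := hm₁ (K N) (hmN.trans (hNK N hN))
    have h3 : (K N : ℝ) ^ (4 - τ) ≤ 16 * (N : ℝ) ^ (4 - τ / 2) := by
      calc (K N : ℝ) ^ (4 - τ) ≤ (2 * (N : ℝ) ^ (1 + ε)) ^ (4 - τ) :=
            Real.rpow_le_rpow (Nat.cast_nonneg _) (hKle N hN) (by linarith)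
        _ = 2 ^ (4 - τ) * (N : ℝ) ^ ((1 + ε) * (4 - τ)) := by
            rw [Real.mul_rpow (by norm_num) (by positivity), ← Real.rpow_mul hN0.le]
        _ ≤ 2 ^ (4 : ℝ) * (N : ℝ) ^ (4 - τ / 2) := by
            gcongr
            · norm_num
            · linarith
            · rw [hε]; nlinarith
        _ = _ := by norm_num
    have h4 : ((N : ℝ) ^ 2)⁻¹ * (1 / (N : ℝ) ^ 2 * (N : ℝ) ^ (4 - τ / 2))
        = (N : ℝ) ^ (-(τ / 2)) := by
      rw [one_div, ← mul_assoc, ← mul_inv, ← pow_add, ← Real.rpow_natCast, ← Real.rpow_neg hN0.le,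
        ← Real.rpow_add hN0]
      congr 1
      push_cast; ring
    calc _ ≤ ((N : ℝ) ^ 2)⁻¹ * (C₂ / (N : ℝ) ^ 2 * (C * (16 * (N : ℝ) ^ (4 - τ / 2)))) := by
          gcongr
          refine h1.trans ?_
          gcongr
          refine h2.trans ?_
          gcongr
      _ = C₂ * C * 16 * (((N : ℝ) ^ 2)⁻¹ * (1 / (N : ℝ) ^ 2 * (N : ℝ) ^ (4 - τ / 2))) := by ring
      _ = _ := by rw [h4]
  have hbase : ∀ m : ℕ, 1 ≤ m + m₀ := fun m => by omega
  have hNm1 : ∀ m : ℕ, 1 ≤ (m + m₀) ^ P := fun m => Nat.one_le_pow _ _ (hbase m)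
  have hNm2 : ∀ m : ℕ, m + m₀ ≤ (m + m₀) ^ P := fun m => Nat.le_self_pow (by omega) _
  have hae := ae_tendsto_zero_of_summable_integral
    (F := fun m α => ((((m + m₀) ^ P : ℕ) : ℝ) ^ 2)⁻¹ * (Real.exp (-Real.pi * α ^ 2)
      * ‖bumpOsc x b ((m + m₀) ^ P) (K ((m + m₀) ^ P)) α‖ ^ 2))
    (a := fun m => C₂ * C * 16 * (1 / ((m + m₀ : ℕ) : ℝ) ^ 2))
    (fun m α => by positivity)
    (fun m => ((hvar _ _ (hNm1 m) (hNK _ (hNm1 m))).1).const_mul _)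
    (fun m => by
      refine (hvarN _ (hNm1 m) (le_trans (by omega) (hNm2 m))).trans ?_
      refine mul_le_mul_of_nonneg_left ?_ (by positivity)
      have hm1 : (1 : ℝ) ≤ ((m + m₀ : ℕ) : ℝ) := by exact_mod_cast hbase m
      rw [Nat.cast_pow, ← Real.rpow_natCast, ← Real.rpow_mul (by linarith), one_div,
        ← Real.rpow_natCast, ← Real.rpow_neg (by linarith)]
      refine Real.rpow_le_rpow_of_exponent_le hm1 ?_
      rw [div_le_iff₀ hτ] at hPτ
      push_cast
      linarith)
    (((summable_nat_add_iff m₀).2 (Real.summable_one_div_nat_pow.2 one_lt_two)).mul_left _)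
  filter_upwards [hae] with α hα
  rw [← tendsto_add_atTop_iff_nat m₀]
  have hNtend : Tendsto (fun m : ℕ => (((m + m₀) ^ P : ℕ) : ℝ)) atTop atTop :=
    tendsto_natCast_atTop_atTop.comp
      (tendsto_atTop_mono (fun m => (Nat.le_add_right m m₀).trans (hNm2 m)) tendsto_id)
  have hinv := tendsto_inv_atTop_zero.comp hNtend
  have hosc : Tendsto (fun m : ℕ => (((m + m₀) ^ P : ℕ) : ℝ)⁻¹
      * ‖bumpOsc x b ((m + m₀) ^ P) (K ((m + m₀) ^ P)) α‖) atTop (𝓝 0) := by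
    have h1 := (hα.const_mul (Real.exp (-Real.pi * α ^ 2))⁻¹).sqrt
    rw [mul_zero, Real.sqrt_zero] at h1
    refine h1.congr fun m => ?_
    rw [Real.sqrt_eq_iff_mul_self_eq (by positivity) (by positivity)]
    have := (Real.exp_pos (-Real.pi * α ^ 2)).ne'
    field_simp
  have herr : Tendsto (fun m : ℕ => C₁ * ((((m + m₀) ^ P : ℕ) : ℝ) ^ (A + 3)
      / (K ((m + m₀) ^ P) : ℝ) ^ A)) atTop (𝓝 0) := by
    have h1 := hinv.const_mul C₁
    rw [mul_zero] at h1
    refine squeeze_zero (fun m => by positivity) (fun m => ?_) h1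
    refine mul_le_mul_of_nonneg_left ?_ hC₁.le
    simp only [Function.comp_apply]
    have hN1 : (1 : ℝ) ≤ (((m + m₀) ^ P : ℕ) : ℝ) := by exact_mod_cast hNm1 m
    have hKN := hKge ((m + m₀) ^ P)
    generalize K ((m + m₀) ^ P) = k at *
    generalize (((m + m₀) ^ P : ℕ) : ℝ) = n at *
    have hn0 : 0 < n := by linarith
    have hk : n ^ (A + 4) ≤ (k : ℝ) ^ A := by
      calc n ^ (A + 4) = n ^ ((A : ℝ) + 4) := by
            rw [← Real.rpow_natCast]; congr 1; push_cast; ring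
        _ ≤ n ^ ((1 + ε) * A) := Real.rpow_le_rpow_of_exponent_le hN1 (by linarith)
        _ = (n ^ (1 + ε)) ^ A := by rw [← Real.rpow_natCast, ← Real.rpow_mul hn0.le]
        _ ≤ (k : ℝ) ^ A := by gcongr
    have hk0 : 0 < (k : ℝ) ^ A := lt_of_lt_of_le (by positivity) hk
    rw [div_le_iff₀ hk0, ← div_eq_inv_mul, le_div_iff₀ hn0]
    calc n ^ (A + 3) * n = n ^ (A + 4) := by ring
      _ ≤ _ := hk
  have hmain : Tendsto (fun m : ℕ => bumpStat x b ((m + m₀) ^ P) α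
      - (1 - (((m + m₀) ^ P : ℕ) : ℝ)⁻¹) * ∫ u, b u) atTop (𝓝 0) := by
    have hsum := hosc.add herr
    rw [add_zero] at hsum
    refine squeeze_zero_norm (fun m => ?_) hsum
    rw [Real.norm_eq_abs]
    exact hstat _ (hNm1 m) _ ((hNm1 m).trans (hNK _ (hNm1 m))) α
  have hmean : Tendsto (fun m : ℕ => (1 - (((m + m₀) ^ P : ℕ) : ℝ)⁻¹) * ∫ u, b u) atTop
      (𝓝 (∫ u, b u)) := by
    have := (hinv.const_sub 1).mul_const (∫ u, b u)
    simpa using this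
  have := hmain.add hmean
  simpa using this

/-! ### From the smoothed statistic to sharp pair counts -/

lemma summable_bump_translates (b : ContDiffBump (0 : ℝ)) {N : ℝ} (hN : 0 < N) (w : ℝ) :
    Summable (fun n : ℤ => b (N * (w + n))) := by
  refine summable_of_ne_finset_zero
    (s := Finset.Icc ⌊-w - b.rOut / N⌋ ⌈-w + b.rOut / N⌉) fun n hn => ?_
  refine b.zero_of_le_dist ?_
  rw [Real.dist_eq, sub_zero, abs_mul, abs_of_pos hN, ← div_le_iff₀' hN]
  by_contra! h
  rw [abs_lt] at h
  refine hn (Finset.mem_Icc.2 ⟨?_, ?_⟩)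
  · exact Int.cast_le (R := ℝ).1 ((Int.floor_le _).trans (by linarith))
  · exact Int.cast_le (R := ℝ).1 (le_trans (by linarith) (Int.le_ceil _))

lemma periodization_nonneg (b : ContDiffBump (0 : ℝ)) (N w : ℝ) : 0 ≤ periodization b N w :=
  tsum_nonneg fun _ => b.nonneg

lemma one_le_periodization (b : ContDiffBump (0 : ℝ)) {N : ℝ} (hN : 0 < N) {w : ℝ} {n : ℤ}
    (h : |w + n| ≤ b.rIn / N) : 1 ≤ periodization b N w := by
  have h1 : b (N * (w + n)) = 1 := by
    refine b.one_of_mem_closedBall ?_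
    rw [Metric.mem_closedBall, Real.dist_eq, sub_zero, abs_mul, abs_of_pos hN]
    rwa [le_div_iff₀' hN] at h
  rw [← h1]
  exact (summable_bump_translates b hN w).le_tsum n (fun _ _ => b.nonneg)

/-- For `N > 2 rOut` the supports of the integer translates are disjoint, so at most one term of the
sum is nonzero. -/
lemma periodization_le (b : ContDiffBump (0 : ℝ)) {N : ℝ} (hN : 2 * b.rOut < N) (w : ℝ) :
    periodization b N w ≤ 1 ∧ ((∀ n : ℤ, b.rOut / N < |w + n|) → periodization b N w = 0) := by
  have hN0 : 0 < N := by linarith [b.rOut_pos]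
  have hzero : ∀ n : ℤ, b.rOut / N ≤ |w + n| → b (N * (w + n)) = 0 := by
    intro n hn
    refine b.zero_of_le_dist ?_
    rw [Real.dist_eq, sub_zero, abs_mul, abs_of_pos hN0]
    rwa [div_le_iff₀' hN0] at hn
  refine ⟨?_, fun h => ?_⟩
  · by_cases h : ∃ n : ℤ, |w + n| < b.rOut / N
    · obtain ⟨n, hn⟩ := h
      have hhalf : b.rOut / N < 1 / 2 := by
        rw [div_lt_iff₀ hN0]; linarith
      have : periodization b N w = b (N * (w + n)) := by
        refine tsum_eq_single n fun n' hn' => hzero n' ?_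
        by_contra! hlt
        have h1 := abs_lt.1 hn
        have h2 := abs_lt.1 hlt
        refine hn' ?_
        have h3 : (n' : ℝ) < n + 1 := by linarith
        have h4 : (n : ℝ) < n' + 1 := by linarith
        have h5 : n' < n + 1 := by exact_mod_cast h3
        have h6 : n < n' + 1 := by exact_mod_cast h4
        omega
      rw [this]
      exact b.le_one
    · push Not at h
      have : periodization b N w = 0 := by
        rw [periodization, tsum_congr fun n => hzero n (h n), tsum_zero]
      rw [this]
      exact zero_le_one
  · rw [periodization, tsum_congr fun n => hzero n (h n).le, tsum_zero]

lemma pairCount_eq (x : ℕ → ℝ) (α s : ℝ) (N : ℕ) :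
    (pairCount (fun n => α * x n) s N : ℝ)
      = ∑ p ∈ nePairs N, if distNearestInt (α * x p.1 - α * x p.2) ≤ s / N then (1 : ℝ) else 0 := by
  classical
  rw [pairCount, ← Finset.filter_filter, Finset.card_filter]
  push_cast
  rfl

lemma inv_mul_pairCount_le_bumpStat (x : ℕ → ℝ) (α : ℝ) (b : ContDiffBump (0 : ℝ)) {N : ℕ}
    (hN : 1 ≤ N) :
    (N : ℝ)⁻¹ * pairCount (fun n => α * x n) b.rIn N ≤ bumpStat x b N α := by
  have hN0 : (0 : ℝ) < N := by exact_mod_cast hN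
  rw [pairCount_eq, bumpStat]
  gcongr with p hp
  split_ifs with h
  · refine one_le_periodization b hN0 (n := round (α * x p.1 - α * x p.2)) ?_
    rw [distNearestInt, abs_sub_comm] at h
    convert! h using 2
    rw [gap]; ring
  · exact periodization_nonneg _ _ _

lemma bumpStat_le_inv_mul_pairCount (x : ℕ → ℝ) (α : ℝ) (b : ContDiffBump (0 : ℝ)) {N : ℕ}
    (hN : 2 * b.rOut < N) :
    bumpStat x b N α ≤ (N : ℝ)⁻¹ * pairCount (fun n => α * x n) b.rOut N := by
  have hN0 : (0 : ℝ) < N := by linarith [b.rOut_pos]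
  rw [pairCount_eq, bumpStat]
  gcongr with p hp
  obtain ⟨h1, h2⟩ := periodization_le b hN (α * gap x p)
  split_ifs with h
  · exact h1
  · refine (h2 fun n => ?_).le
    rw [not_le, distNearestInt] at h
    refine h.trans_le ((round_le _ n).trans_eq ?_)
    rw [abs_sub_comm]
    congr 1
    rw [gap]; ring

/-- Used to compare a general `N` with the neighbouring `P`-th powers, at the price of changing `s`
slightly. -/
lemma pairCount_mono (y : ℕ → ℝ) {s s' : ℝ} {N N' : ℕ} (hN : N ≤ N')
    (hs : s / (N : ℝ) ≤ s' / (N' : ℝ)) : pairCount y s N ≤ pairCount y s' N' := by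
  classical
  refine Finset.card_le_card fun p hp => ?_
  simp only [Finset.mem_filter, Finset.mem_product, Finset.mem_Icc] at hp ⊢
  obtain ⟨⟨⟨h1, h2⟩, h3, h4⟩, h5, h6⟩ := hp
  exact ⟨⟨⟨h1, h2.trans hN⟩, h3, h4.trans hN⟩, h5, h6.trans hs⟩

/-- The bump function with given rational radii. -/
noncomputable def ratBump (q : {q : ℚ × ℚ // 0 < q.1 ∧ q.1 < q.2}) : ContDiffBump (0 : ℝ) where
  rIn := q.1.1
  rOut := q.1.2
  rIn_pos := by exact_mod_cast q.2.1
  rIn_lt_rOut := by exact_mod_cast q.2.2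

lemma two_mul_rIn_le_integral (b : ContDiffBump (0 : ℝ)) : 2 * b.rIn ≤ ∫ u, b u := by
  have h := b.measure_closedBall_le_integral volume
  rwa [Real.closedBall_eq_Icc, Real.volume_real_Icc_of_le (by linarith [b.rIn_pos]),
    show 0 + b.rIn - (0 - b.rIn) = 2 * b.rIn by ring] at h

lemma integral_le_two_mul_rOut (b : ContDiffBump (0 : ℝ)) : ∫ u, b u ≤ 2 * b.rOut := by
  have h := b.integral_le_measure_closedBall (μ := volume)
  rwa [Real.closedBall_eq_Icc, Real.volume_real_Icc_of_le (by linarith [b.rOut_pos]),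
    show 0 + b.rOut - (0 - b.rOut) = 2 * b.rOut by ring] at h

/-- The integer part of the `P`-th root. -/
def floorRoot (P N : ℕ) : ℕ := Nat.findGreatest (fun m => m ^ P ≤ N) N

lemma floorRoot_pow_le {P N : ℕ} (hP : 1 ≤ P) : floorRoot P N ^ P ≤ N :=
  Nat.findGreatest_spec (P := fun m => m ^ P ≤ N) (m := 0) (Nat.zero_le _)
    (by simp [show P ≠ 0 by omega])

lemma lt_floorRoot_succ_pow {P N : ℕ} (hP : 1 ≤ P) : N < (floorRoot P N + 1) ^ P := by
  by_contra! h
  have h1 : floorRoot P N + 1 ≤ N := (Nat.le_self_pow (by omega) _).trans h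
  have h2 := Nat.le_findGreatest (P := fun m => m ^ P ≤ N) h1 h
  exact absurd h2 (Nat.not_succ_le_self _)

lemma tendsto_floorRoot {P : ℕ} (hP : 1 ≤ P) : Tendsto (floorRoot P) atTop atTop := by
  refine tendsto_atTop.2 fun k => ?_
  filter_upwards [eventually_ge_atTop (k ^ P)] with N hN
  exact Nat.le_findGreatest ((Nat.le_self_pow (by omega) k).trans hN) hN

lemma tendsto_ratio_pow (P : ℕ) :
    Tendsto (fun m : ℕ => (((m + 1 : ℕ) : ℝ) / m) ^ P) atTop (𝓝 1) := by
  have h1 : Tendsto (fun m : ℕ => 1 + ((m : ℝ))⁻¹) atTop (𝓝 1) := by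
    simpa using (tendsto_inv_atTop_zero.comp tendsto_natCast_atTop_atTop).const_add (1 : ℝ)
  have h2 := h1.pow P
  rw [one_pow] at h2
  refine h2.congr' ?_
  filter_upwards [eventually_ge_atTop 1] with m hm
  have : (m : ℝ) ≠ 0 := by exact_mod_cast (by omega : m ≠ 0)
  congr 1
  push_cast
  field_simp

lemma tendsto_succ_pow_div {P : ℕ} (hP : 1 ≤ P) :
    Tendsto (fun N : ℕ => (((floorRoot P N + 1) ^ P : ℕ) : ℝ) / N) atTop (𝓝 1) := by
  refine tendsto_of_tendsto_of_tendsto_of_le_of_le' tendsto_const_nhds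
    ((tendsto_ratio_pow P).comp (tendsto_floorRoot hP)) ?_ ?_
  · filter_upwards [eventually_ge_atTop 1] with N hN
    have hN0 : (0 : ℝ) < N := by exact_mod_cast hN
    rw [le_div_iff₀ hN0, one_mul]
    exact_mod_cast (lt_floorRoot_succ_pow hP).le
  · filter_upwards [(tendsto_floorRoot hP).eventually_ge_atTop 1] with N hm
    have hm0 : (0 : ℝ) < floorRoot P N := by exact_mod_cast hm
    have h : ((floorRoot P N : ℝ)) ^ P ≤ N := by exact_mod_cast floorRoot_pow_le hP
    simp only [Function.comp_apply]
    rw [div_pow, Nat.cast_pow]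
    gcongr

lemma tendsto_pow_div {P : ℕ} (hP : 1 ≤ P) :
    Tendsto (fun N : ℕ => ((floorRoot P N ^ P : ℕ) : ℝ) / N) atTop (𝓝 1) := by
  have h0 := ((tendsto_ratio_pow P).comp (tendsto_floorRoot hP)).inv₀ one_ne_zero
  rw [inv_one] at h0
  refine tendsto_of_tendsto_of_tendsto_of_le_of_le' h0 tendsto_const_nhds ?_ ?_
  · filter_upwards [(tendsto_floorRoot hP).eventually_ge_atTop 1, eventually_ge_atTop 1]
      with N hm hN
    have hm0 : (0 : ℝ) < floorRoot P N := by exact_mod_cast hm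
    have hN0 : (0 : ℝ) < N := by exact_mod_cast hN
    have h : (N : ℝ) ≤ ((floorRoot P N + 1 : ℕ) : ℝ) ^ P := by
      exact_mod_cast (lt_floorRoot_succ_pow hP).le
    simp only [Function.comp_apply]
    rw [div_pow, inv_div, Nat.cast_pow]
    gcongr
  · filter_upwards [eventually_ge_atTop 1] with N hN
    have hN0 : (0 : ℝ) < N := by exact_mod_cast hN
    rw [div_le_one hN0]
    exact_mod_cast floorRoot_pow_le hP

/-- Convergence of the smoothed statistics along `m ^ P` gives Poissonian pair correlation. -/
lemma hasPoissonianPairCorrelation_of_tendsto_bumpStat {x : ℕ → ℝ} {α : ℝ} {P : ℕ} (hP : 1 ≤ P)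
    (h : ∀ q, Tendsto (fun m : ℕ => bumpStat x (ratBump q) (m ^ P) α) atTop
      (𝓝 (∫ u, ratBump q u))) :
    HasPoissonianPairCorrelation (fun n => α * x n) := by
  intro s hs
  rw [tendsto_order]
  constructor
  · intro a ha
    -- With `a / 2 < q₁ < q₂ < s` the bump has integral above `a`, while its support radius leaves
    -- room: for the largest `P`-th power `M ≤ N`, `M / N → 1` gives `q₂ / M ≤ s / N` eventually.
    obtain ⟨q₁, hq₁, hq₁s⟩ := exists_rat_btwn (max_lt (by linarith : a / 2 < s) hs)
    obtain ⟨q₂, hq₂, hq₂s⟩ := exists_rat_btwn hq₁s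
    have hq₁0 : (0 : ℝ) < q₁ := (le_max_right _ _).trans_lt hq₁
    have haq : a / 2 < q₁ := (le_max_left _ _).trans_lt hq₁
    have hq := h ⟨(q₁, q₂), by exact_mod_cast hq₁0, by exact_mod_cast hq₂⟩
    set b := ratBump ⟨(q₁, q₂), by exact_mod_cast hq₁0, by exact_mod_cast hq₂⟩ with hb
    have hout : b.rOut = q₂ := rfl
    have hin : b.rIn = q₁ := rfl
    have hlim := (tendsto_pow_div hP).mul (hq.comp (tendsto_floorRoot hP))
    rw [one_mul] at hlim
    have hJ : a < ∫ u, b u := by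
      have := two_mul_rIn_le_integral b
      rw [hin] at this
      linarith
    have hs2 := (tendsto_pow_div hP).const_mul s
    rw [mul_one] at hs2
    filter_upwards [hlim.eventually (lt_mem_nhds hJ), hs2.eventually (lt_mem_nhds hq₂s),
      (tendsto_floorRoot hP).eventually_ge_atTop 1,
      (tendsto_floorRoot hP).eventually_ge_atTop (⌊2 * b.rOut⌋₊ + 1),
      eventually_ge_atTop 1] with N h1 h2 hm hmb hN
    have hN0 : (0 : ℝ) < N := by exact_mod_cast hN
    have hMpos : 1 ≤ floorRoot P N ^ P := Nat.one_le_pow _ _ hm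
    have hmM : floorRoot P N ≤ floorRoot P N ^ P := Nat.le_self_pow (by omega) _
    have hMN : floorRoot P N ^ P ≤ N := floorRoot_pow_le hP
    simp only [Function.comp_apply] at h1
    generalize floorRoot P N ^ P = M at *
    have hM0 : (0 : ℝ) < M := by exact_mod_cast hMpos
    have hbig : 2 * b.rOut < M :=
      (Nat.lt_floor_add_one _).trans_le (by exact_mod_cast hmb.trans hmM)
    have h3 := bumpStat_le_inv_mul_pairCount x α b hbig
    have h4 : pairCount (fun n => α * x n) b.rOut M ≤ pairCount (fun n => α * x n) s N := by
      refine pairCount_mono _ hMN ?_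
      rw [hout, div_le_div_iff₀ hM0 hN0]
      rw [← mul_div_assoc, lt_div_iff₀ hN0] at h2
      exact h2.le
    calc a < (M : ℝ) / N * bumpStat x b M α := h1
      _ ≤ (M : ℝ) / N * ((M : ℝ)⁻¹ * pairCount (fun n => α * x n) b.rOut M) := by gcongr
      _ = 1 / N * pairCount (fun n => α * x n) b.rOut M := by field_simp
      _ ≤ _ := by gcongr
  · intro a ha
    -- Dually `s < q₁ < q₂ < a / 2`, with `M` the next `P`-th power above `N`; the bump equals 1 out
    -- to `q₁`, and its integral is below `a`.
    obtain ⟨q₂, hq₂, hq₂a⟩ := exists_rat_btwn (by linarith : s < a / 2)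
    obtain ⟨q₁, hq₁, hq₁2⟩ := exists_rat_btwn hq₂
    have hq₁0 : (0 : ℝ) < q₁ := hs.trans hq₁
    have hq := h ⟨(q₁, q₂), by exact_mod_cast hq₁0, by exact_mod_cast hq₁2⟩
    set b := ratBump ⟨(q₁, q₂), by exact_mod_cast hq₁0, by exact_mod_cast hq₁2⟩ with hb
    have hout : b.rOut = q₂ := rfl
    have hin : b.rIn = q₁ := rfl
    have hlim := (tendsto_succ_pow_div hP).mul
      (hq.comp ((tendsto_add_atTop_nat 1).comp (tendsto_floorRoot hP)))
    rw [one_mul] at hlim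
    have hJ : ∫ u, b u < a := by
      have := integral_le_two_mul_rOut b
      rw [hout] at this
      linarith
    have hs2 := (tendsto_succ_pow_div hP).const_mul s
    rw [mul_one] at hs2
    filter_upwards [hlim.eventually (gt_mem_nhds hJ), hs2.eventually (gt_mem_nhds hq₁),
      eventually_ge_atTop 1] with N h1 h2 hN
    have hN0 : (0 : ℝ) < N := by exact_mod_cast hN
    have hMpos : 1 ≤ (floorRoot P N + 1) ^ P := Nat.one_le_pow _ _ (by omega)
    have hNM : N ≤ (floorRoot P N + 1) ^ P := (lt_floorRoot_succ_pow hP).le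
    simp only [Function.comp_apply] at h1
    generalize (floorRoot P N + 1) ^ P = M at *
    have hM0 : (0 : ℝ) < M := by exact_mod_cast hMpos
    have h3 := inv_mul_pairCount_le_bumpStat x α b hMpos
    have h4 : pairCount (fun n => α * x n) s N ≤ pairCount (fun n => α * x n) b.rIn M := by
      refine pairCount_mono _ hNM ?_
      rw [hin, div_le_div_iff₀ hN0 hM0]
      rw [← mul_div_assoc, div_lt_iff₀ hN0] at h2
      exact h2.le
    calc 1 / (N : ℝ) * pairCount (fun n => α * x n) s N
        ≤ 1 / N * pairCount (fun n => α * x n) b.rIn M := by gcongr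
      _ = (M : ℝ) / N * ((M : ℝ)⁻¹ * pairCount (fun n => α * x n) b.rIn M) := by field_simp
      _ ≤ (M : ℝ) / N * bumpStat x b M α := by gcongr
      _ < a := h1

theorem mainTheorem1 (x : ℕ → ℝ)
    (hpos : ∀ n : ℕ, 1 ≤ n → 0 < x n)
    (c η : ℝ) (hc : 0 < c) (hη : 2 / 3 < η) (hη1 : η ≤ 1)
    (hspacing : ∀ n : ℕ, 1 ≤ n → c / (n : ℝ) ^ (1 - η) ≤ x (n + 1) - x n)
    (δ κ : ℝ) (hδ : 0 < δ) (hκ : 0 ≤ κ) (hκ1 : κ < 1)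
    (henergy : (fun N : ℕ => (approxEnergy x N (1 / (N : ℝ)) : ℝ))
      =O[atTop] (fun N : ℕ => (N : ℝ) ^ (3 - κ - δ)))
    (hgrowth : (fun N : ℕ => gapSum x N)
      =O[atTop] (fun N : ℕ => (N : ℝ) ^ (1 + κ / 2))) :
    IsMetricPoissonian x := by
  obtain ⟨τ, hτ, hτ1, C, hC, hQ⟩ :=
    exists_ratioCount_le hc hη hη1 hspacing hδ hκ henergy hgrowth
  obtain ⟨P, hP, hae⟩ := exists_ae_tendsto_bumpStat x
    (fun N p hp => gap_pos hc hη1 hspacing hp) hτ hτ1 hC hQ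
  -- Rational radii leave only countably many bumps, so one null set serves them all and hence every
  -- `s`.
  have hall := ae_all_iff.2 fun q => hae (ratBump q)
  filter_upwards [hall] with α hα
  exact hasPoissonianPairCorrelation_of_tendsto_bumpStat hP hα
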